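/- Let $V \in L^1(\mathbb{R})$ be a real-valued potential with $V \neq 0$ (that is, $V$ does not vanish almost everywhere), $V \leq 0$ almost everywhere, and \[ \int_{\mathbb{R}} (1 + x^2) \, |V(x)| \, \mathrm{d}x < \infty . \] For $\lambda > 0$ let $H_\lambda = -\partial_x^2 + \lambda V$ be the Schrödinger operator on $L^2(\mathbb{R})$ with domain $\mathcal{D}(H_\lambda) = \{ \psi \in L^2(\mathbb{R}) : V\psi \in L^1_{\mathrm{loc}}(\mathbb{R}),\ -\psi'' + \lambda V \psi \in L^2(\mathbb{R}) \}$, where $-\psi'' + \lambda V \psi$ is understood in the sense of distributions. Then for every $\lambda > 0$ (not only for small $\lambda$) $H_\lambda$ has at least one negative eigenvalue. More precisely, the number \[ E_0 := \inf_{\varphi \in \mathcal{D}(H_\lambda),\ \|\varphi\| = 1} \langle \varphi, H_\lambda \varphi \rangle \] is finite, satisfies $E_0 < 0$, and is an eigenvalue of $H_\lambda$: there is $\psi \in \mathcal{D}(H_\lambda)$, $\psi \neq 0$, with $H_\lambda \psi = E_0 \psi$. -/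

import Mathlib

open MeasureTheory
open scoped ContDiff

noncomputable section

/-- The complex Hilbert space `L²(ℝ)`. -/
abbrev L2R : Type := Lp ℂ 2 (volume : Measure ℝ)

/-- `IsSchrodingerImage W ψ φ` says that `-ψ'' + W ψ = φ` in the sense of distributions on `ℝ`:
`W ψ` is locally integrable (so that it is a distribution) and the equation holds after pairing
with every test function `η ∈ C_c^∞(ℝ)`. -/
def IsSchrodingerImage (W : ℝ → ℝ) (ψ φ : L2R) : Prop :=
  LocallyIntegrable (fun x => W x • ψ x) (volume : Measure ℝ) ∧
    ∀ η : ℝ → ℝ, ContDiff ℝ ∞ η → HasCompactSupport η →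
      (∫ x, -(iteratedDeriv 2 η x) • ψ x) + ∫ x, η x • (W x • ψ x) = ∫ x, η x • φ x

theorem L2R.locallyIntegrable (ψ : L2R) : LocallyIntegrable ψ (volume : Measure ℝ) :=
  (Lp.memLp ψ).locallyIntegrable (by norm_num)

theorem integrable_test_smul {η : ℝ → ℝ} (hη : Continuous η) (hc : HasCompactSupport η)
    {f : ℝ → ℂ} (hf : LocallyIntegrable f (volume : Measure ℝ)) :
    Integrable (fun x => η x • f x) (volume : Measure ℝ) :=
  hf.integrable_smul_left_of_hasCompactSupport hη hc

theorem continuous_neg_iteratedDeriv_two {η : ℝ → ℝ} (hη : ContDiff ℝ ∞ η) :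
    Continuous (fun x => -(iteratedDeriv 2 η x)) :=
  (hη.continuous_iteratedDeriv 2 (WithTop.coe_le_coe.2 le_top)).neg

theorem hasCompactSupport_neg_iteratedDeriv_two {η : ℝ → ℝ} (hc : HasCompactSupport η) :
    HasCompactSupport (fun x => -(iteratedDeriv 2 η x)) := by
  have h : HasCompactSupport (iteratedDeriv 2 η) := by
    rw [iteratedDeriv_succ, iteratedDeriv_one]
    exact hc.deriv.deriv
  exact h.comp_left (g := fun y : ℝ => -y) neg_zero

/-- The graph `{(ψ, φ) ∈ L²(ℝ) × L²(ℝ) | -ψ'' + W ψ = φ}` of the Schrödinger operator. -/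
def schrodingerGraph (W : ℝ → ℝ) : Submodule ℂ (L2R × L2R) where
  carrier := {p | IsSchrodingerImage W p.1 p.2}
  zero_mem' := by
    have h0 : ((0 : L2R) : ℝ → ℂ) =ᵐ[volume] 0 := Lp.coeFn_zero _ _ _
    have h1 : ∀ f : ℝ → ℝ, (∫ x, f x • ((0 : L2R) : ℝ → ℂ) x) = 0 := fun f => by
      rw [integral_eq_zero_of_ae]
      filter_upwards [h0] with x hx
      exact (congrArg (f x • ·) hx).trans (smul_zero _)
    refine ⟨?_, fun η _ _ => ?_⟩
    · refine (locallyIntegrable_zero (X := ℝ) (ε'' := ℂ) (μ := volume)).congr ?_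
      filter_upwards [h0] with x hx
      exact ((congrArg (W x • ·) hx).trans (smul_zero _)).symm
    · simp only [Prod.fst_zero, Prod.snd_zero, smul_smul]
      rw [h1, h1, h1, add_zero]
  add_mem' := by
    rintro ⟨ψ, φ⟩ ⟨ψ', φ'⟩ ⟨h1, h2⟩ ⟨h1', h2'⟩
    have hψ := Lp.coeFn_add ψ ψ'
    have hφ := Lp.coeFn_add φ φ'
    refine ⟨?_, fun η hη hc => ?_⟩
    · refine (h1.add h1').congr ?_
      filter_upwards [hψ] with x hx
      exact (smul_add (W x) (ψ x) (ψ' x)).symm.trans (congrArg (W x • ·) hx.symm)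
    · have e1 : (∫ x, -(iteratedDeriv 2 η x) • (ψ + ψ' : L2R) x)
          = (∫ x, -(iteratedDeriv 2 η x) • ψ x) + ∫ x, -(iteratedDeriv 2 η x) • ψ' x := by
        have c1 := continuous_neg_iteratedDeriv_two hη
        have c2 := hasCompactSupport_neg_iteratedDeriv_two hc
        rw [← integral_add (integrable_test_smul c1 c2 ψ.locallyIntegrable)
          (integrable_test_smul c1 c2 ψ'.locallyIntegrable)]
        refine integral_congr_ae ?_
        filter_upwards [hψ] with x hx
        exact (congrArg (-(iteratedDeriv 2 η x) • ·) hx).trans (smul_add _ (ψ x) (ψ' x))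
      have e2 : (∫ x, η x • (W x • (ψ + ψ' : L2R) x))
          = (∫ x, η x • (W x • ψ x)) + ∫ x, η x • (W x • ψ' x) := by
        rw [← integral_add (integrable_test_smul hη.continuous hc h1)
          (integrable_test_smul hη.continuous hc h1')]
        refine integral_congr_ae ?_
        filter_upwards [hψ] with x hx
        exact (congrArg (fun z => η x • (W x • z)) hx).trans
          ((congrArg (η x • ·) (smul_add (W x) (ψ x) (ψ' x))).trans (smul_add _ _ _))
      have e3 : (∫ x, η x • (φ + φ' : L2R) x)
          = (∫ x, η x • φ x) + ∫ x, η x • φ' x := by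
        rw [← integral_add (integrable_test_smul hη.continuous hc φ.locallyIntegrable)
          (integrable_test_smul hη.continuous hc φ'.locallyIntegrable)]
        refine integral_congr_ae ?_
        filter_upwards [hφ] with x hx
        exact (congrArg (η x • ·) hx).trans (smul_add _ (φ x) (φ' x))
      have a := h2 η hη hc
      have b := h2' η hη hc
      simp only [Prod.mk_add_mk] at *
      rw [e1, e2, e3, ← a, ← b]
      ring
  smul_mem' := by
    rintro c ⟨ψ, φ⟩ ⟨h1, h2⟩
    have hψ := Lp.coeFn_smul c ψ
    have hφ := Lp.coeFn_smul c φ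
    refine ⟨?_, fun η hη hc => ?_⟩
    · refine (h1.smul c).congr ?_
      filter_upwards [hψ] with x hx
      simp [hx]
      ring
    · have e1 : (∫ x, -(iteratedDeriv 2 η x) • (c • ψ : L2R) x)
          = c * ∫ x, -(iteratedDeriv 2 η x) • ψ x := by
        rw [← integral_const_mul]
        refine integral_congr_ae ?_
        filter_upwards [hψ] with x hx
        simp [hx]
        ring
      have e2 : (∫ x, η x • (W x • (c • ψ : L2R) x))
          = c * ∫ x, η x • (W x • ψ x) := by
        rw [← integral_const_mul]
        refine integral_congr_ae ?_
        filter_upwards [hψ] with x hx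
        simp [hx]
        ring
      have e3 : (∫ x, η x • (c • φ : L2R) x) = c * ∫ x, η x • φ x := by
        rw [← integral_const_mul]
        refine integral_congr_ae ?_
        filter_upwards [hφ] with x hx
        simp [hx]
        ring
      have a := h2 η hη hc
      simp only [Prod.smul_mk] at *
      rw [e1, e2, e3, ← a]
      ring

/-- The Schrödinger operator `H = -∂ₓ² + W` on `L²(ℝ)`, an unbounded operator with domain
`{ψ ∈ L²(ℝ) | -ψ'' + W ψ ∈ L²(ℝ)}`, where `-ψ'' + W ψ` is taken in the sense of distributions. -/
def schrodingerOp (W : ℝ → ℝ) : L2R →ₗ.[ℂ] L2R :=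
  (schrodingerGraph W).toLinearPMap

/-- The set `schrodingerGraph W` is the graph of a function. -/
theorem schrodingerGraph_functional (W : ℝ → ℝ) (p : L2R × L2R) (hp : p ∈ schrodingerGraph W)
    (h0 : p.1 = 0) : p.2 = 0 := by
  obtain ⟨ψ, φ⟩ := p
  obtain ⟨-, h2⟩ := hp
  simp only at h0 h2 ⊢
  subst h0
  have hz : ((0 : L2R) : ℝ → ℂ) =ᵐ[volume] 0 := Lp.coeFn_zero _ _ _
  have h1 : ∀ f : ℝ → ℝ, (∫ x, f x • ((0 : L2R) : ℝ → ℂ) x) = 0 := fun f => by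
    rw [integral_eq_zero_of_ae]
    filter_upwards [hz] with x hx
    exact (congrArg (f x • ·) hx).trans (smul_zero _)
  have h3 : ∀ᵐ x ∂(volume : Measure ℝ), φ x = 0 :=
    ae_eq_zero_of_integral_contDiff_smul_eq_zero φ.locallyIntegrable fun η hη hc => by
      have h := h2 η hη hc
      simp only [smul_smul] at h
      rw [h1, h1, add_zero] at h
      exact h.symm
  exact (Lp.eq_zero_iff_ae_eq_zero).2 h3

/-- `ψ` lies in the domain of `H = -∂ₓ² + W` with `H ψ = φ` iff `-ψ'' + W ψ = φ` weakly. -/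
theorem mem_graph_schrodingerOp_iff (W : ℝ → ℝ) (ψ φ : L2R) :
    (ψ, φ) ∈ (schrodingerOp W).graph ↔ IsSchrodingerImage W ψ φ := by
  rw [schrodingerOp, Submodule.toLinearPMap_graph_eq _ (schrodingerGraph_functional W)]
  rfl

/-- `E` is an eigenvalue of the operator `T`. -/
def IsEigenvalue (T : L2R →ₗ.[ℂ] L2R) (E : ℝ) : Prop :=
  ∃ ψ : T.domain, ψ ≠ 0 ∧ T ψ = (E : ℂ) • (ψ : L2R)

/-- The energy expectations `⟨φ, T φ⟩` of the normalized vectors `φ` in the domain of `T`. -/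
def energyValues (T : L2R →ₗ.[ℂ] L2R) : Set ℝ :=
  {e | ∃ φ : T.domain, ‖(φ : L2R)‖ = 1 ∧ e = (inner ℂ (φ : L2R) (T φ)).re}

end

open Set Filter Topology
open scoped NNReal

noncomputable section

/-! Write `λV = -q` with `q ≥ 0`, and let `μ` be the finite nonzero measure `q dx`. The resolvent
kernel of `-∂²` at energy `-k²` is `exp(-k|x-y|)/(2k)`, so `-u'' - q u = -k² u` with `u ∈ L²`
corresponds (Birman–Schwinger) to the eigenvalue `2k` of the compact symmetric operator `S_k` on
`L²(μ)` with kernel `exp(-k|x-y|)`. Its norm is continuous in `k > 0`, at most `μ(ℝ)`, and bounded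
below by a positive constant as `k → 0`; hence `‖S_k‖ = 2k` for some `k > 0`. The failure of the
bound `2k` for small `k` is the divergence of the one-dimensional resolvent at zero energy, which is
why every coupling binds. Compactness and positivity of the kernel turn the norm into an eigenvalue
with a nonnegative eigenfunction, which yields a strictly positive solution `u` with `|u'| ≤ k u`
(`exists_positive_eigenfunction`).

That `-k²` is the infimum of the energies comes from the ground state transformation (Jacobi's
identity). For a real component `b` of a domain element and the matching component `h` of its image,
`k² b² + h b` equals the square `(b' - (u'/u) b)²` plus the derivative of `(u'/u) b² - b' b`
(`boundary_le_integral`). Integrating over ℝ gives `⟨ψ, Hψ⟩ ≥ -k² ‖ψ‖²`, provided that the boundary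
terms do no harm. No decay of `b'` is needed: as `u'/u` is bounded and `|ψ|²` is integrable,
suitable sequences of endpoints suffice (`exists_ge_neg_le_boundary`). Since `u` itself lies in the
domain, the bound is attained. -/

/-! ### Integration by parts and regularity of distributional solutions. -/

theorem MeasureTheory.LocallyIntegrable.intervalIntegrable' {f : ℝ → ℝ}
    (hf : LocallyIntegrable f volume) (a b : ℝ) : IntervalIntegrable f volume a b :=
  (hf.integrableOn_isCompact isCompact_uIcc).intervalIntegrable

/-- Integration by parts for the primitive `F` of an integrable function and a `C¹` function. -/
theorem integral_mul_add_mul_eq_sub_of_primitive {F f g g' : ℝ → ℝ}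
    (hf : LocallyIntegrable f volume) (hF : ∀ x y, F y - F x = ∫ t in x..y, f t)
    (hg : ∀ x, HasDerivAt g (g' x) x) (hg' : Continuous g') (a b : ℝ) :
    ∫ t in a..b, (f t * g t + F t * g' t) = F b * g b - F a * g a := by
  have hfi : IntervalIntegrable f volume a b := hf.intervalIntegrable' a b
  have hFeq : F = fun x => F a + ∫ t in a..x, f t := by
    ext x; rw [← hF a x]; ring
  have hFac : AbsolutelyContinuousOnInterval F a b := by
    have h1 : AbsolutelyContinuousOnInterval (fun _ : ℝ => F a) a b :=
      (contDiff_const.contDiffOn).absolutelyContinuousOnInterval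
    rw [hFeq]
    exact h1.add (hfi.absolutelyContinuousOnInterval_intervalIntegral left_mem_uIcc)
  have hgc : ContDiff ℝ 1 g := by
    rw [contDiff_one_iff_deriv]
    refine ⟨fun x => (hg x).differentiableAt, ?_⟩
    rwa [show deriv g = g' from funext fun x => (hg x).deriv]
  have hgac : AbsolutelyContinuousOnInterval g a b :=
    hgc.contDiffOn.absolutelyContinuousOnInterval
  rw [← hFac.integral_deriv_mul_eq_sub hgac]
  refine intervalIntegral.integral_congr_ae ?_
  filter_upwards [hfi.ae_hasDerivAt_integral] with x hx hx'
  have h := (hx (uIoc_subset_uIcc hx') a left_mem_uIcc).const_add (F a)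
  rw [← hFeq] at h
  rw [h.deriv, (hg x).deriv]

theorem continuous_of_primitive {F f : ℝ → ℝ} (hf : LocallyIntegrable f volume)
    (hF : ∀ x y, F y - F x = ∫ t in x..y, f t) : Continuous F := by
  have hFeq : F = fun x => F 0 + ∫ t in (0 : ℝ)..x, f t := by
    ext x; rw [← hF 0 x]; ring
  rw [hFeq]
  exact continuous_const.add
    (intervalIntegral.continuous_primitive (hf.intervalIntegrable') 0)

theorem exists_Ioo_of_hasCompactSupport {η : ℝ → ℝ} (hc : HasCompactSupport η) :
    ∃ R > 0, tsupport η ⊆ Ioo (-R) R := by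
  obtain ⟨R, hR⟩ := hc.isBounded.subset_ball 0
  refine ⟨max R 1, by positivity, fun x hx => ?_⟩
  have := hR hx
  rw [Metric.mem_ball, Real.dist_eq, sub_zero] at this
  exact abs_lt.1 (this.trans_le (le_max_left _ _))

/-- Integration by parts against a compactly supported `C¹` function. -/
theorem integral_deriv_mul_primitive {F f η η' : ℝ → ℝ} (hf : LocallyIntegrable f volume)
    (hF : ∀ x y, F y - F x = ∫ t in x..y, f t) (hη : ∀ x, HasDerivAt η (η' x) x)
    (hη' : Continuous η') (hc : HasCompactSupport η) :
    ∫ x, η' x * F x = -∫ x, η x * f x := by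
  obtain ⟨R, hR, hsub⟩ := exists_Ioo_of_hasCompactSupport hc
  have hd : deriv η = η' := funext fun x => (hη x).deriv
  have hηc : Continuous η := continuous_iff_continuousAt.2 fun x => (hη x).continuousAt
  have hsub' : Function.support η' ⊆ Ioo (-R) R :=
    hd ▸ (support_deriv_subset.trans hsub)
  have hz : ∀ x, x ∉ Ioo (-R) R → η x = 0 := fun x hx => by
    by_contra h; exact hx (hsub (subset_closure h))
  have e1 : ∫ x, η' x * F x = ∫ x in (-R)..R, η' x * F x :=
    (intervalIntegral.integral_eq_integral_of_support_subset
      ((Function.support_mul_subset_left _ _).trans (hsub'.trans Ioo_subset_Ioc_self))).symm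
  have e2 : ∫ x, η x * f x = ∫ x in (-R)..R, η x * f x :=
    (intervalIntegral.integral_eq_integral_of_support_subset
      ((Function.support_mul_subset_left _ _).trans
        (subset_closure.trans (hsub.trans Ioo_subset_Ioc_self)))).symm
  have key := integral_mul_add_mul_eq_sub_of_primitive hf hF hη hη' (-R) R
  rw [intervalIntegral.integral_add
    ((hf.intervalIntegrable' _ _).mul_continuousOn hηc.continuousOn)
    (show IntervalIntegrable (fun t => F t * η' t) volume (-R) R from
      ((continuous_of_primitive hf hF).mul hη').intervalIntegrable _ _),
    hz R (by simp), hz (-R) (by simp)] at key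
  rw [e1, e2]
  have c1 : ∫ t in (-R)..R, f t * η t = ∫ t in (-R)..R, η t * f t := by
    simp only [mul_comm]
  have c2 : ∫ t in (-R)..R, F t * η' t = ∫ t in (-R)..R, η' t * F t := by
    simp only [mul_comm]
  rw [c1, c2] at key
  linarith

theorem primitive_of_hasDerivAt {Φ G : ℝ → ℝ} (hΦ : ∀ x, HasDerivAt Φ (G x) x)
    (hG : Continuous G) (x y : ℝ) : Φ y - Φ x = ∫ t in x..y, G t :=
  (intervalIntegral.integral_eq_sub_of_hasDerivAt (fun t _ => hΦ t)
    (hG.intervalIntegrable _ _)).symm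

/-- If `Φ` is `C¹` and `Φ'` is a primitive of `g`, then `Φ'' = g` in the sense of distributions. -/
theorem integral_iteratedDeriv_two_mul {Φ G g η : ℝ → ℝ} (hg : LocallyIntegrable g volume)
    (hΦ : ∀ x, HasDerivAt Φ (G x) x) (hG : ∀ x y, G y - G x = ∫ t in x..y, g t)
    (hη : ContDiff ℝ ∞ η) (hc : HasCompactSupport η) :
    ∫ x, iteratedDeriv 2 η x * Φ x = ∫ x, η x * g x := by
  have hGc := continuous_of_primitive hg hG
  have hd : ContDiff ℝ ∞ (deriv η) := by
    have := (contDiff_infty_iff_deriv (𝕜 := ℝ)).1 hη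
    exact this.2
  have hdd : ContDiff ℝ ∞ (deriv (deriv η)) := ((contDiff_infty_iff_deriv (𝕜 := ℝ)).1 hd).2
  have e : iteratedDeriv 2 η = deriv (deriv η) := by
    rw [iteratedDeriv_succ, iteratedDeriv_one]
  have h1 := integral_deriv_mul_primitive hGc.locallyIntegrable
    (primitive_of_hasDerivAt hΦ hGc)
    (fun x => ((hd.differentiable (by simp)) x).hasDerivAt) hdd.continuous hc.deriv
  have h2 := integral_deriv_mul_primitive hg hG
    (fun x => ((hη.differentiable (by simp)) x).hasDerivAt) hd.continuous hc
  rw [e, h1, h2, neg_neg]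

/-- A test function of mean zero is the derivative of a test function. -/
theorem exists_test_primitive {ζ : ℝ → ℝ} (hζ : ContDiff ℝ ∞ ζ) (hc : HasCompactSupport ζ)
    (h0 : ∫ x, ζ x = 0) :
    ∃ η : ℝ → ℝ, ContDiff ℝ ∞ η ∧ HasCompactSupport η ∧ deriv η = ζ := by
  obtain ⟨R, hR, hsub⟩ := exists_Ioo_of_hasCompactSupport hc
  have hz : ∀ x, x ∉ Ioo (-R) R → ζ x = 0 := fun x hx => by
    by_contra h; exact hx (hsub (subset_closure h))
  have hder : ∀ x, HasDerivAt (fun x => ∫ t in (-R)..x, ζ t) (ζ x) x := fun x =>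
    intervalIntegral.integral_hasDerivAt_right (hζ.continuous.intervalIntegrable _ _)
      (hζ.continuous.stronglyMeasurableAtFilter _ _) hζ.continuous.continuousAt
  have hd : deriv (fun x => ∫ t in (-R)..x, ζ t) = ζ := funext fun x => (hder x).deriv
  refine ⟨fun x => ∫ t in (-R)..x, ζ t, ?_, ?_, hd⟩
  · rw [contDiff_infty_iff_deriv, hd]
    exact ⟨fun x => (hder x).differentiableAt, hζ⟩
  · refine HasCompactSupport.intro (isCompact_Icc (a := -R) (b := R)) fun x hx => ?_
    rcases lt_or_ge x (-R) with h | h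
    · rw [intervalIntegral.integral_congr (g := fun _ => (0 : ℝ)), intervalIntegral.integral_zero]
      intro t ht
      rw [uIcc_of_ge h.le] at ht
      exact hz t fun h' => absurd h'.1 (not_lt.2 ht.2)
    · have hx' : R < x := by
        by_contra h'; exact hx ⟨h, not_lt.1 h'⟩
      -- To the right of the support the primitive is the full integral, so this is where mean zero
      -- enters.
      rw [intervalIntegral.integral_eq_integral_of_support_subset, h0]
      intro t ht
      have : t ∈ Ioo (-R) R := by by_contra h'; exact ht (hz t h')
      exact ⟨this.1, this.2.le.trans hx'.le⟩

theorem exists_test_integral_one :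
    ∃ χ : ℝ → ℝ, ContDiff ℝ ∞ χ ∧ HasCompactSupport χ ∧ ∫ x, χ x = 1 := by
  let f : ContDiffBump (0 : ℝ) := default
  exact ⟨f.normed volume, f.contDiff_normed, f.hasCompactSupport_normed, f.integral_normed⟩

/-- The lemma of du Bois-Reymond. -/
theorem ae_eq_const_of_integral_deriv_mul_eq_zero {f : ℝ → ℝ} (hf : LocallyIntegrable f volume)
    (h : ∀ η : ℝ → ℝ, ContDiff ℝ ∞ η → HasCompactSupport η → ∫ x, deriv η x * f x = 0) :
    ∃ c : ℝ, ∀ᵐ x, f x = c := by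
  obtain ⟨χ, hχ, hχc, hχ1⟩ := exists_test_integral_one
  set c := ∫ x, χ x * f x with hcdef
  refine ⟨c, ?_⟩
  have hi : ∀ ζ : ℝ → ℝ, ContDiff ℝ ∞ ζ → HasCompactSupport ζ →
      Integrable (fun x => ζ x * f x) := fun ζ h1 h2 =>
    hf.integrable_smul_left_of_hasCompactSupport h1.continuous h2
  have hae := ae_eq_zero_of_integral_contDiff_smul_eq_zero
    (f := fun x => f x - c) (hf.sub (locallyIntegrable_const c)) (fun ζ hζ hζc => by
      set m := ∫ x, ζ x with hm
      have hζi : Integrable ζ := hζ.continuous.integrable_of_hasCompactSupport hζc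
      have hχi : Integrable χ := hχ.continuous.integrable_of_hasCompactSupport hχc
      -- Subtracting `m χ` makes the mean zero, so the hypothesis on derivatives applies and gives
      -- `∫ ζ f = m c = ∫ ζ c`.
      obtain ⟨η, hη, hηc, hd⟩ := exists_test_primitive (ζ := fun x => ζ x - m * χ x)
        (hζ.sub (contDiff_const.mul hχ)) (hζc.sub (hχc.mul_left))
        (by rw [integral_sub hζi (hχi.const_mul m), integral_const_mul, hχ1, mul_one, sub_self])
      have h0 := h η hη hηc
      rw [hd] at h0
      have e1 : ∫ x, (ζ x - m * χ x) * f x = (∫ x, ζ x * f x) - m * c := by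
        rw [hcdef, ← integral_const_mul, ← integral_sub (hi ζ hζ hζc) ((hi χ hχ hχc).const_mul m)]
        congr 1; ext x; ring
      have e2 : ∫ x, ζ x • (f x - c) = (∫ x, ζ x * f x) - m * c := by
        rw [hm, ← integral_mul_const, ← integral_sub (hi ζ hζ hζc) (hζi.mul_const c)]
        congr 1; ext x; simp only [smul_eq_mul]; ring
      rw [e2, ← e1, h0])
  filter_upwards [hae] with x hx
  linarith

/-- A function with vanishing second distributional derivative is affine. -/
theorem ae_eq_affine_of_integral_iteratedDeriv_two_mul_eq_zero {f : ℝ → ℝ}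
    (hf : LocallyIntegrable f volume)
    (h : ∀ η : ℝ → ℝ, ContDiff ℝ ∞ η → HasCompactSupport η →
      ∫ x, iteratedDeriv 2 η x * f x = 0) :
    ∃ c d : ℝ, ∀ᵐ x, f x = c + d * x := by
  obtain ⟨χ, hχ, hχc, hχ1⟩ := exists_test_integral_one
  have hdc : ∀ {η : ℝ → ℝ}, ContDiff ℝ ∞ η → ContDiff ℝ ∞ (deriv η) := fun hη =>
    ((contDiff_infty_iff_deriv (𝕜 := ℝ)).1 hη).2
  set d := ∫ x, deriv χ x * f x with hddef
  have hi : ∀ ζ : ℝ → ℝ, ContDiff ℝ ∞ ζ → HasCompactSupport ζ →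
      Integrable (fun x => ζ x * f x) := fun ζ h1 h2 =>
    hf.integrable_smul_left_of_hasCompactSupport h1.continuous h2
  have hlin : LocallyIntegrable (fun x : ℝ => d * x) volume :=
    (continuous_const.mul continuous_id).locallyIntegrable
  -- The slope of `f` is `-d`. Testing with `η' = ζ - m χ` gives `∫ ζ' f = m d`, while `∫ ζ' x =
  -- -m`; so `f + d x` has zero weak derivative.
  obtain ⟨c, hc⟩ := ae_eq_const_of_integral_deriv_mul_eq_zero
    (f := fun x => f x + d * x) (hf.add hlin) (fun ζ hζ hζc => by
      set m := ∫ x, ζ x with hm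
      have hζi : Integrable ζ := hζ.continuous.integrable_of_hasCompactSupport hζc
      have hχi : Integrable χ := hχ.continuous.integrable_of_hasCompactSupport hχc
      obtain ⟨η, hη, hηc, hd⟩ := exists_test_primitive (ζ := fun x => ζ x - m * χ x)
        (hζ.sub (contDiff_const.mul hχ)) (hζc.sub (hχc.mul_left))
        (by rw [integral_sub hζi (hχi.const_mul m), integral_const_mul, hχ1, mul_one, sub_self])
      have h0 := h η hη hηc
      have hdd : iteratedDeriv 2 η = fun x => deriv ζ x - m * deriv χ x := by
        rw [iteratedDeriv_succ, iteratedDeriv_one, hd]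
        ext x
        exact (((hζ.differentiable (by simp)) x).hasDerivAt.sub
          (((hχ.differentiable (by simp)) x).hasDerivAt.const_mul m)).deriv
      have hb : ∫ x, deriv ζ x * x = -m := by
        have := integral_deriv_mul_primitive (f := fun _ => (1 : ℝ)) (F := fun x => x)
          (locallyIntegrable_const 1) (fun x y => by simp)
          (fun x => ((hζ.differentiable (by simp)) x).hasDerivAt) (hdc hζ).continuous hζc
        simpa [hm] using this
      rw [hdd] at h0
      have e1 : ∫ x, (deriv ζ x - m * deriv χ x) * f x = (∫ x, deriv ζ x * f x) - m * d := by
        rw [hddef, ← integral_const_mul, ← integral_sub (hi _ (hdc hζ) hζc.deriv)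
          ((hi _ (hdc hχ) hχc.deriv).const_mul m)]
        congr 1; ext x; ring
      have e2 : ∫ x, deriv ζ x * (f x + d * x) = (∫ x, deriv ζ x * f x) + d * -m := by
        have hii : Integrable (fun x => deriv ζ x * x) :=
          continuous_id.locallyIntegrable.integrable_smul_left_of_hasCompactSupport
            (hdc hζ).continuous hζc.deriv
        rw [← hb, ← integral_const_mul, ← integral_add (hi _ (hdc hζ) hζc.deriv)
          (hii.const_mul d)]
        congr 1; ext x; ring
      rw [e2]
      linarith)
  refine ⟨c, -d, ?_⟩
  filter_upwards [hc] with x hx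
  linarith

/-- A function whose second distributional derivative is a locally integrable function has a `C¹`
representative whose derivative is absolutely continuous. -/
theorem exists_C1_representative {a g : ℝ → ℝ} (ha : LocallyIntegrable a volume)
    (hg : LocallyIntegrable g volume)
    (h : ∀ η : ℝ → ℝ, ContDiff ℝ ∞ η → HasCompactSupport η →
      ∫ x, iteratedDeriv 2 η x * a x = ∫ x, η x * g x) :
    ∃ b b' : ℝ → ℝ, a =ᵐ[volume] b ∧ (∀ x, HasDerivAt b (b' x) x) ∧
      ∀ x y, b' y - b' x = ∫ t in x..y, g t := by
  set G : ℝ → ℝ := fun x => ∫ t in (0 : ℝ)..x, g t with hGdef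
  have hG : ∀ x y, G y - G x = ∫ t in x..y, g t := fun x y =>
    intervalIntegral.integral_interval_sub_left (hg.intervalIntegrable' _ _) (hg.intervalIntegrable' _ _)
  have hGc := continuous_of_primitive hg hG
  set Φ : ℝ → ℝ := fun x => ∫ t in (0 : ℝ)..x, G t with hΦdef
  have hΦ : ∀ x, HasDerivAt Φ (G x) x := fun x =>
    intervalIntegral.integral_hasDerivAt_right (hGc.intervalIntegrable _ _)
      (hGc.stronglyMeasurableAtFilter _ _) hGc.continuousAt
  have hΦc : Continuous Φ := continuous_iff_continuousAt.2 fun x => (hΦ x).continuousAt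
  obtain ⟨c, d, hcd⟩ := ae_eq_affine_of_integral_iteratedDeriv_two_mul_eq_zero
    (f := fun x => a x - Φ x) (ha.sub hΦc.locallyIntegrable) (fun η hη hc => by
      have c2 : Continuous (iteratedDeriv 2 η) :=
        hη.continuous_iteratedDeriv 2 (WithTop.coe_le_coe.2 le_top)
      have s2 : HasCompactSupport (iteratedDeriv 2 η) := by
        rw [iteratedDeriv_succ, iteratedDeriv_one]
        exact hc.deriv.deriv
      have i1 : Integrable (fun x => iteratedDeriv 2 η x * a x) :=
        ha.integrable_smul_left_of_hasCompactSupport c2 s2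
      have i2 : Integrable (fun x => iteratedDeriv 2 η x * Φ x) :=
        hΦc.locallyIntegrable.integrable_smul_left_of_hasCompactSupport c2 s2
      simp only [mul_sub]
      rw [integral_sub i1 i2, h η hη hc, integral_iteratedDeriv_two_mul hg hΦ hG hη hc, sub_self])
  refine ⟨fun x => Φ x + (c + d * x), fun x => G x + d, ?_, fun x => ?_, fun x y => ?_⟩
  · filter_upwards [hcd] with x hx
    linarith
  · have := (hΦ x).add (((hasDerivAt_id x).const_mul d).const_add c)
    rw [mul_one] at this
    exact this
  · rw [← hG]; ring

/-! ### Attainment of the norm by weak compactness. -/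

/-- An operator on a separable Hilbert space which maps bounded weakly convergent sequences to
norm convergent ones attains its norm on the closed unit ball. -/
theorem exists_norm_apply_eq_opNorm {H : Type*} [NormedAddCommGroup H] [InnerProductSpace ℝ H]
    [CompleteSpace H] [TopologicalSpace.SeparableSpace H] (S : H →L[ℝ] H)
    (hS : ∀ (u : ℕ → H) (w : H), (∀ n, ‖u n‖ ≤ 1) →
      (∀ v, Tendsto (fun n => inner ℝ (u n) v) atTop (𝓝 (inner ℝ w v))) →
      Tendsto (fun n => S (u n)) atTop (𝓝 (S w))) :
    ∃ u : H, ‖u‖ ≤ 1 ∧ ‖S u‖ = ‖S‖ := by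
  have h1 : ∀ n : ℕ, ∃ x : H, ‖x‖ < 1 ∧ ‖S‖ - 1 / ((n : ℝ) + 1) < ‖S x‖ := fun n =>
    S.exists_lt_apply_of_lt_opNorm (by
      have : (0 : ℝ) < 1 / ((n : ℝ) + 1) := by positivity
      linarith)
  choose x hx1 hx2 using h1
  -- The Riesz isomorphism moves the almost maximizing sequence to the dual, whose closed unit ball
  -- is weak-* sequentially compact because `H` is separable.
  have hmem : ∀ n, StrongDual.toWeakDual (InnerProductSpace.toDual ℝ H (x n)) ∈
      (WeakDual.toStrongDual ⁻¹' Metric.closedBall (0 : StrongDual ℝ H) 1) := fun n => by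
    simpa using (hx1 n).le
  obtain ⟨l, hl, φ, hφ, hlim⟩ := WeakDual.isSeqCompact_closedBall ℝ H 0 1 hmem
  set w : H := (InnerProductSpace.toDual ℝ H).symm (WeakDual.toStrongDual l) with hw
  have hweak : ∀ v, Tendsto (fun n => inner ℝ (x (φ n)) v) atTop (𝓝 (inner ℝ w v)) := fun v => by
    have h := ((WeakDual.eval_continuous v).tendsto l).comp hlim
    rw [hw, InnerProductSpace.toDual_symm_apply]
    exact h
  have hT := hS _ w (fun n => (hx1 (φ n)).le) hweak
  have hwn : ‖w‖ ≤ 1 := by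
    rw [hw, LinearIsometryEquiv.norm_map]
    simpa using hl
  refine ⟨w, hwn, le_antisymm ?_ ?_⟩
  · calc ‖S w‖ ≤ ‖S‖ * ‖w‖ := S.le_opNorm w
      _ ≤ ‖S‖ * 1 := by gcongr
      _ = ‖S‖ := mul_one _
  · have h2 : Tendsto (fun n : ℕ => ‖S‖ - 1 / ((φ n : ℝ) + 1)) atTop (𝓝 (‖S‖ - 0)) :=
      tendsto_const_nhds.sub (tendsto_one_div_add_atTop_nhds_zero_nat.comp hφ.tendsto_atTop)
    rw [sub_zero] at h2
    exact le_of_tendsto_of_tendsto' h2 hT.norm fun n => (hx2 (φ n)).le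

/-! ### The Birman–Schwinger operator with kernel `exp(-|k||x-y|)` on `L²(μ)`. -/

section ExpKernel

variable (μ : Measure ℝ)

/-- The function `x ↦ ∫ exp (-|k| |x - y|) u y dμ(y)`. -/
def expKernelIntegral (k : ℝ) (u : ℝ → ℝ) (x : ℝ) : ℝ :=
  ∫ y, Real.exp (-(|k| * |x - y|)) * u y ∂μ

theorem exp_kernel_le_one (k x y : ℝ) : Real.exp (-(|k| * |x - y|)) ≤ 1 :=
  Real.exp_le_one_iff.2 (neg_nonpos.2 (by positivity))

variable {μ}

theorem integrable_exp_kernel_mul {u : ℝ → ℝ} (hu : Integrable u μ) (k x : ℝ) :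
    Integrable (fun y => Real.exp (-(|k| * |x - y|)) * u y) μ :=
  hu.bdd_mul (c := 1) (by fun_prop) (Eventually.of_forall fun y => by
    rw [Real.norm_eq_abs, Real.abs_exp]; exact exp_kernel_le_one k x y)

theorem abs_expKernelIntegral_le {u : ℝ → ℝ} (hu : Integrable u μ) (k x : ℝ) :
    |expKernelIntegral μ k u x| ≤ ∫ y, |u y| ∂μ := by
  refine (abs_integral_le_integral_abs).trans
    (integral_mono (integrable_exp_kernel_mul hu k x).abs hu.abs fun y => ?_)
  simp only [abs_mul, Real.abs_exp]
  exact mul_le_of_le_one_left (abs_nonneg _) (exp_kernel_le_one k x y)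

theorem continuous_expKernelIntegral {u : ℝ → ℝ} (hu : Integrable u μ) (k : ℝ) :
    Continuous (expKernelIntegral μ k u) := by
  refine continuous_of_dominated (bound := fun y => |u y|)
    (fun x => (integrable_exp_kernel_mul hu k x).aestronglyMeasurable) (fun x => ?_) hu.abs ?_
  · refine Eventually.of_forall fun y => ?_
    rw [Real.norm_eq_abs, abs_mul, Real.abs_exp]
    exact mul_le_of_le_one_left (abs_nonneg _) (exp_kernel_le_one k x y)
  · exact Eventually.of_forall fun y => by fun_prop

theorem L2_inner_eq_integral (u v : Lp ℝ 2 μ) : inner ℝ u v = ∫ x, u x * v x ∂μ := by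
  rw [L2.inner_def]
  simp [mul_comm]

theorem sqrt_mul_sqrt_univ :
    (measureUnivNNReal μ : ℝ) ^ (2 : ℝ)⁻¹ * (measureUnivNNReal μ : ℝ) ^ (2 : ℝ)⁻¹
      = measureUnivNNReal μ := by
  rw [← Real.rpow_add_of_nonneg (by positivity) (by norm_num) (by norm_num)]
  norm_num

variable [IsFiniteMeasure μ]

theorem integrable_of_L2 (u : Lp ℝ 2 μ) : Integrable u μ :=
  (Lp.memLp u).integrable (by norm_num)

theorem integral_abs_le_norm (u : Lp ℝ 2 μ) :
    ∫ x, |u x| ∂μ ≤ (measureUnivNNReal μ : ℝ) ^ (2 : ℝ)⁻¹ * ‖u‖ := by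
  have h := eLpNorm_le_eLpNorm_mul_rpow_measure_univ (μ := μ) (p := 1) (q := 2)
    (by norm_num) (Lp.aestronglyMeasurable u)
  have h1 : ∫ x, |u x| ∂μ = (eLpNorm u 1 μ).toReal := by
    rw [eLpNorm_one_eq_lintegral_enorm]
    exact integral_norm_eq_lintegral_enorm (Lp.aestronglyMeasurable u)
  rw [h1, Lp.norm_def, mul_comm, ← coe_measureUnivNNReal μ] at *
  have h2 : (1 : ℝ) / (1 : ENNReal).toReal - 1 / (2 : ENNReal).toReal = (2 : ℝ)⁻¹ := by norm_num
  rw [h2] at h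
  have h3 := ENNReal.toReal_mono (ENNReal.mul_ne_top
    (ENNReal.rpow_ne_top_of_nonneg (by norm_num) ENNReal.coe_ne_top) (Lp.memLp u).2.ne) h
  rw [ENNReal.toReal_mul, ← ENNReal.toReal_rpow] at h3
  exact h3.trans_eq (mul_comm _ _)

theorem memLp_expKernelIntegral (k : ℝ) (u : Lp ℝ 2 μ) :
    MemLp (expKernelIntegral μ k u) 2 μ :=
  MemLp.of_bound (continuous_expKernelIntegral (integrable_of_L2 u) k).aestronglyMeasurable
    (∫ y, |u y| ∂μ) (Eventually.of_forall fun x =>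
      abs_expKernelIntegral_le (integrable_of_L2 u) k x)

/-- A bounded function which is at most `C ‖u‖₁` has `L²` norm at most `C μ(ℝ) ‖u‖₂`. -/
theorem norm_le_of_ae_abs_le (u v : Lp ℝ 2 μ) {C : ℝ} (hC : 0 ≤ C)
    (h : ∀ᵐ x ∂μ, |v x| ≤ C * ∫ y, |u y| ∂μ) :
    ‖v‖ ≤ C * measureUnivNNReal μ * ‖u‖ := by
  have h0 : 0 ≤ ∫ y, |u y| ∂μ := integral_nonneg fun _ => abs_nonneg _
  calc ‖v‖ ≤ (measureUnivNNReal μ : ℝ) ^ (2 : ENNReal).toReal⁻¹ * (C * ∫ y, |u y| ∂μ) :=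
        Lp.norm_le_of_ae_bound (by positivity) h
    _ ≤ (measureUnivNNReal μ : ℝ) ^ (2 : ℝ)⁻¹ *
          (C * ((measureUnivNNReal μ : ℝ) ^ (2 : ℝ)⁻¹ * ‖u‖)) := by
        rw [ENNReal.toReal_ofNat]
        gcongr
        exact integral_abs_le_norm u
    _ = C * ((measureUnivNNReal μ : ℝ) ^ (2 : ℝ)⁻¹ * (measureUnivNNReal μ : ℝ) ^ (2 : ℝ)⁻¹)
          * ‖u‖ := by ring
    _ = _ := by rw [sqrt_mul_sqrt_univ]

variable (μ) in
/-- The integral operator with kernel `exp (-|k| |x - y|)` on `L²(μ)`. -/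
def expKernelOp (k : ℝ) : Lp ℝ 2 μ →L[ℝ] Lp ℝ 2 μ :=
  LinearMap.mkContinuous
    { toFun := fun u => (memLp_expKernelIntegral k u).toLp _
      map_add' := fun u v => by
        rw [← MemLp.toLp_add]
        refine MemLp.toLp_congr _ _ (Eventually.of_forall fun x => ?_)
        simp only [expKernelIntegral, Pi.add_apply]
        rw [← integral_add (integrable_exp_kernel_mul (integrable_of_L2 u) k x)
          (integrable_exp_kernel_mul (integrable_of_L2 v) k x)]
        refine integral_congr_ae ?_
        filter_upwards [Lp.coeFn_add u v] with y hy
        rw [hy, Pi.add_apply, mul_add]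
      map_smul' := fun c u => by
        rw [RingHom.id_apply, ← MemLp.toLp_const_smul]
        refine MemLp.toLp_congr _ _ (Eventually.of_forall fun x => ?_)
        simp only [expKernelIntegral, Pi.smul_apply, smul_eq_mul]
        rw [← integral_const_mul]
        refine integral_congr_ae ?_
        filter_upwards [Lp.coeFn_smul c u] with y hy
        rw [hy, Pi.smul_apply, smul_eq_mul]
        ring }
    (measureUnivNNReal μ) (fun u => by
      have h := norm_le_of_ae_abs_le u ((memLp_expKernelIntegral k u).toLp _) zero_le_one (by
        filter_upwards [(memLp_expKernelIntegral k u).coeFn_toLp] with x hx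
        rw [hx, one_mul]
        exact abs_expKernelIntegral_le (integrable_of_L2 u) k x)
      rw [one_mul] at h
      exact h)

theorem coeFn_expKernelOp (k : ℝ) (u : Lp ℝ 2 μ) :
    expKernelOp μ k u =ᵐ[μ] expKernelIntegral μ k u :=
  (memLp_expKernelIntegral k u).coeFn_toLp

theorem norm_expKernelOp_le (k : ℝ) : ‖expKernelOp μ k‖ ≤ measureUnivNNReal μ :=
  LinearMap.mkContinuous_norm_le _ (by positivity) _

/-- Fubini and the symmetry of the kernel. -/
theorem inner_expKernelOp_left (k : ℝ) (u v : Lp ℝ 2 μ) :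
    inner ℝ (expKernelOp μ k u) v = inner ℝ u (expKernelOp μ k v) := by
  have e1 : inner ℝ (expKernelOp μ k u) v
      = ∫ x, ∫ y, Real.exp (-(|k| * |x - y|)) * (v x * u y) ∂μ ∂μ := by
    rw [L2_inner_eq_integral]
    refine integral_congr_ae ?_
    filter_upwards [coeFn_expKernelOp k u] with x hx
    rw [hx, expKernelIntegral, ← integral_mul_const]
    congr 1; ext y; ring
  have e2 : inner ℝ u (expKernelOp μ k v)
      = ∫ y, ∫ x, Real.exp (-(|k| * |x - y|)) * (v x * u y) ∂μ ∂μ := by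
    rw [L2_inner_eq_integral]
    refine integral_congr_ae ?_
    filter_upwards [coeFn_expKernelOp k v] with x hx
    rw [hx, expKernelIntegral, ← integral_const_mul]
    congr 1; ext y; rw [abs_sub_comm]; ring
  rw [e1, e2]
  refine integral_integral_swap ?_
  refine ((integrable_of_L2 v).mul_prod (integrable_of_L2 u)).bdd_mul (c := 1)
    (by fun_prop) (Eventually.of_forall fun p => ?_)
  rw [Real.norm_eq_abs, Real.abs_exp]
  exact exp_kernel_le_one k p.1 p.2

theorem memLp_exp_kernel (k x : ℝ) :
    MemLp (fun y => Real.exp (-(|k| * |x - y|))) 2 μ :=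
  MemLp.of_bound (by fun_prop) 1 (Eventually.of_forall fun y => by
    rw [Real.norm_eq_abs, Real.abs_exp]; exact exp_kernel_le_one k x y)

/-- Since `μ` is finite, each kernel section is in `L²(μ)`; evaluation at a point is thus a weakly
continuous functional. -/
theorem expKernelIntegral_eq_inner (k : ℝ) (u : Lp ℝ 2 μ) (x : ℝ) :
    expKernelIntegral μ k u x = inner ℝ u ((memLp_exp_kernel (μ := μ) k x).toLp _) := by
  rw [L2_inner_eq_integral]
  refine integral_congr_ae ?_
  filter_upwards [(memLp_exp_kernel (μ := μ) k x).coeFn_toLp] with y hy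
  rw [hy, mul_comm]

/-- Compactness of the operator: weak convergence gives pointwise convergence of the images, which
are bounded uniformly by a constant; dominated convergence applies as `μ` is finite. -/
theorem tendsto_expKernelOp_of_weak (k : ℝ) (u : ℕ → Lp ℝ 2 μ) (w : Lp ℝ 2 μ)
    (hu : ∀ n, ‖u n‖ ≤ 1)
    (h : ∀ v, Tendsto (fun n => inner ℝ (u n) v) atTop (𝓝 (inner ℝ w v))) :
    Tendsto (fun n => expKernelOp μ k (u n)) atTop (𝓝 (expKernelOp μ k w)) := by
  set D := (measureUnivNNReal μ : ℝ) ^ (2 : ℝ)⁻¹ with hD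
  have hb : ∀ v : Lp ℝ 2 μ, ∀ x, |expKernelIntegral μ k v x| ≤ D * ‖v‖ := fun v x =>
    (abs_expKernelIntegral_le (integrable_of_L2 v) k x).trans (integral_abs_le_norm v)
  have hc : ∀ v : Lp ℝ 2 μ, Continuous (expKernelIntegral μ k v) := fun v =>
    continuous_expKernelIntegral (integrable_of_L2 v) k
  have hD0 : 0 ≤ D := by positivity
  have key : Tendsto (fun n => ‖expKernelOp μ k (u n) - expKernelOp μ k w‖ ^ 2) atTop (𝓝 0) := by
    have e : ∀ n, ‖expKernelOp μ k (u n) - expKernelOp μ k w‖ ^ 2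
        = ∫ x, (expKernelIntegral μ k (u n) x - expKernelIntegral μ k w x) ^ 2 ∂μ := fun n => by
      rw [← real_inner_self_eq_norm_sq, L2_inner_eq_integral]
      refine integral_congr_ae ?_
      filter_upwards [Lp.coeFn_sub (expKernelOp μ k (u n)) (expKernelOp μ k w),
        coeFn_expKernelOp k (u n), coeFn_expKernelOp k w] with x h1 h2 h3
      rw [h1, Pi.sub_apply, h2, h3, sq]
    simp only [e]
    have := tendsto_integral_of_dominated_convergence (μ := μ)
      (F := fun n x => (expKernelIntegral μ k (u n) x - expKernelIntegral μ k w x) ^ 2)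
      (f := fun _ => 0) (fun _ => (D + D * ‖w‖) ^ 2)
      (fun n => (((hc (u n)).sub (hc w)).pow 2).aestronglyMeasurable)
      (integrable_const _) (fun n => Eventually.of_forall fun x => by
        rw [Real.norm_eq_abs, abs_pow]
        gcongr
        refine (abs_sub _ _).trans (add_le_add ((hb (u n) x).trans ?_) (hb w x))
        exact mul_le_of_le_one_right hD0 (hu n))
      (Eventually.of_forall fun x => by
        have h1 : Tendsto (fun n => expKernelIntegral μ k (u n) x) atTop
            (𝓝 (expKernelIntegral μ k w x)) := by
          simp only [expKernelIntegral_eq_inner]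
          exact h _
        have := (h1.sub_const (expKernelIntegral μ k w x)).pow 2
        simpa using this)
    simpa using this
  rw [tendsto_iff_norm_sub_tendsto_zero]
  have := key.sqrt
  simpa [Real.sqrt_sq] using this

/-- Combines `1 - exp(-s) ≤ s` with `t exp(-kt) ≤ 1/k₀`. The bound is uniform in `t`, so it passes
to the operator norm. -/
theorem abs_exp_kernel_sub_le {k₀ k k' t : ℝ} (h0 : 0 < k₀) (hk : k₀ ≤ k) (hk' : k₀ ≤ k')
    (ht : 0 ≤ t) :
    |Real.exp (-(k * t)) - Real.exp (-(k' * t))| ≤ k₀⁻¹ * |k - k'| := by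
  wlog hle : k ≤ k' generalizing k k'
  · rw [abs_sub_comm, abs_sub_comm k]
    exact this hk' hk (not_le.1 hle).le
  have e : Real.exp (-(k' * t)) = Real.exp (-(k * t)) * Real.exp (-((k' - k) * t)) := by
    rw [← Real.exp_add]; congr 1; ring
  have h1 : 1 - Real.exp (-((k' - k) * t)) ≤ (k' - k) * t := by
    have := Real.add_one_le_exp (-((k' - k) * t)); linarith
  have h2 : Real.exp (-((k' - k) * t)) ≤ 1 :=
    Real.exp_le_one_iff.2 (neg_nonpos.2 (mul_nonneg (by linarith) ht))
  have h3 : t * Real.exp (-(k * t)) ≤ k₀⁻¹ := by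
    have h4 : k₀ * t ≤ Real.exp (k * t) :=
      (mul_le_mul_of_nonneg_right hk ht).trans
        (by have := Real.add_one_le_exp (k * t); linarith)
    rw [Real.exp_neg, ← div_eq_mul_inv, div_le_iff₀ (Real.exp_pos _), ← div_eq_inv_mul,
      le_div_iff₀ h0]
    linarith
  rw [e, abs_of_nonneg (by nlinarith [Real.exp_pos (-(k * t))]), abs_of_nonpos (by linarith)]
  calc Real.exp (-(k * t)) - Real.exp (-(k * t)) * Real.exp (-((k' - k) * t))
      = Real.exp (-(k * t)) * (1 - Real.exp (-((k' - k) * t))) := by ring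
    _ ≤ Real.exp (-(k * t)) * ((k' - k) * t) := by gcongr
    _ = (t * Real.exp (-(k * t))) * (k' - k) := by ring
    _ ≤ k₀⁻¹ * (k' - k) := by gcongr
    _ = k₀⁻¹ * -(k - k') := by ring

theorem norm_expKernelOp_sub_le {k₀ k k' : ℝ} (h0 : 0 < k₀) (hk : k₀ ≤ k) (hk' : k₀ ≤ k') :
    ‖expKernelOp μ k - expKernelOp μ k'‖ ≤ k₀⁻¹ * measureUnivNNReal μ * |k - k'| := by
  refine ContinuousLinearMap.opNorm_le_bound _ (by positivity) fun u => ?_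
  have hu := integrable_of_L2 u
  refine (norm_le_of_ae_abs_le u _ (C := k₀⁻¹ * |k - k'|) (by positivity) ?_).trans
    (le_of_eq (by ring))
  rw [sub_apply]
  filter_upwards [Lp.coeFn_sub (expKernelOp μ k u) (expKernelOp μ k' u), coeFn_expKernelOp k u,
    coeFn_expKernelOp k' u] with x h1 h2 h3
  have i1 := integrable_exp_kernel_mul hu k x
  have i2 := integrable_exp_kernel_mul hu k' x
  rw [h1, Pi.sub_apply, h2, h3, expKernelIntegral, expKernelIntegral, ← integral_sub i1 i2,
    ← integral_const_mul]
  refine abs_integral_le_integral_abs.trans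
    (integral_mono (i1.sub i2).abs (hu.abs.const_mul _) fun y => ?_)
  simp only [← sub_mul, abs_mul]
  rw [abs_of_pos (h0.trans_le hk), abs_of_pos (h0.trans_le hk'), ← abs_of_nonneg (abs_nonneg (k - k'))]
  gcongr
  rw [abs_abs]
  exact abs_exp_kernel_sub_le h0 hk hk' (abs_nonneg _)

theorem continuousOn_expKernelOp {k₀ : ℝ} (h0 : 0 < k₀) :
    ContinuousOn (fun k => expKernelOp μ k) (Ici k₀) := by
  refine LipschitzOnWith.continuousOn (K := (k₀⁻¹ * measureUnivNNReal μ).toNNReal)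
    (LipschitzOnWith.of_dist_le_mul fun k hk k' hk' => ?_)
  rw [dist_eq_norm, Real.dist_eq, Real.coe_toNNReal _ (by positivity)]
  exact norm_expKernelOp_sub_le h0 hk hk'

/-- Test the operator on the indicator of the interval: two of its points are at distance at most
`2N`, so the kernel there is at least `exp(-2kN)`. -/
theorem le_norm_expKernelOp {k N : ℝ} (hk : 0 ≤ k) (hN : 0 < μ.real (Icc (-N) N)) :
    Real.exp (-(k * (2 * N))) * μ.real (Icc (-N) N) ≤ ‖expKernelOp μ k‖ := by
  set I := Icc (-N) N
  have hI : MeasurableSet I := measurableSet_Icc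
  set f : Lp ℝ 2 μ := indicatorConstLp 2 hI (measure_ne_top μ I) (1 : ℝ)
  have hf : f =ᵐ[μ] I.indicator fun _ => (1 : ℝ) := indicatorConstLp_coeFn
  have hf0 : 0 < ‖f‖ := by
    rw [norm_indicatorConstLp (by norm_num) (by norm_num)]
    simp only [norm_one, one_mul]
    exact Real.rpow_pos_of_pos hN _
  set c := Real.exp (-(k * (2 * N))) * μ.real I with hc
  have hc0 : 0 ≤ c := by positivity
  refine le_of_mul_le_mul_right ?_ hf0
  refine le_trans ?_ ((expKernelOp μ k).le_opNorm f)
  rw [show c * ‖f‖ = ‖c • f‖ by rw [norm_smul, Real.norm_of_nonneg hc0]]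
  refine Lp.norm_le_norm_of_ae_le ?_
  filter_upwards [Lp.coeFn_smul c f, hf, coeFn_expKernelOp k f] with x h1 h2 h3
  rw [h1, h3, Pi.smul_apply, h2, smul_eq_mul, Real.norm_eq_abs, Real.norm_eq_abs]
  have e : expKernelIntegral μ k f x = ∫ y in I, Real.exp (-(k * |x - y|)) ∂μ := by
    rw [← integral_indicator hI]
    refine integral_congr_ae ?_
    filter_upwards [hf] with y hy
    rw [hy, abs_of_nonneg hk]
    by_cases hyI : y ∈ I <;> simp [hyI]
  by_cases hx : x ∈ I
  · rw [indicator_of_mem hx, mul_one, abs_of_nonneg hc0, e]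
    refine le_trans ?_ (le_abs_self _)
    have : c = ∫ y in I, Real.exp (-(k * (2 * N))) ∂μ := by
      rw [setIntegral_const, smul_eq_mul, mul_comm]
    rw [this]
    refine setIntegral_mono_on (integrable_const _) ?_ hI fun y hy => ?_
    · have := integrable_exp_kernel_mul (integrable_const (μ := μ.restrict I) (1 : ℝ)) k x
      simpa [abs_of_nonneg hk, IntegrableOn] using this
    · have : |x - y| ≤ 2 * N := by
        rw [abs_le]
        constructor <;> linarith [hx.1, hx.2, hy.1, hy.2]
      gcongr
  · rw [indicator_of_notMem hx]
    simp

/-- Intermediate value theorem for `‖S_k‖ - 2k`. Some interval has positive mass, so the lower bound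
on `‖S_k‖` stays away from zero as `k → 0`, whereas `2k` does not. -/
theorem exists_norm_expKernelOp_eq (hμ : μ ≠ 0) : ∃ k > 0, ‖expKernelOp μ k‖ = 2 * k := by
  have hex : ∃ n : ℕ, 0 < μ.real (Icc (-(n : ℝ)) n) := by
    by_contra! h
    apply hμ
    rw [← Measure.measure_univ_eq_zero]
    have hU : (univ : Set ℝ) = ⋃ n : ℕ, Icc (-(n : ℝ)) n := by
      refine (eq_univ_of_forall fun x => ?_).symm
      obtain ⟨n, hn⟩ := exists_nat_ge |x|
      exact mem_iUnion.2 ⟨n, abs_le.1 hn⟩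
    rw [hU, measure_iUnion_null_iff]
    exact fun n => (measureReal_eq_zero_iff).1 (le_antisymm (h n) measureReal_nonneg)
  obtain ⟨n, hn⟩ := hex
  set c := μ.real (Icc (-(n : ℝ)) n)
  have hsmall : ∀ᶠ k : ℝ in 𝓝[>] 0, 2 * k < Real.exp (-(k * (2 * n))) * c := by
    have h1 : Tendsto (fun k : ℝ => Real.exp (-(k * (2 * n))) * c - 2 * k) (𝓝[>] 0) (𝓝 c) := by
      have : Continuous fun k : ℝ => Real.exp (-(k * (2 * n))) * c - 2 * k := by fun_prop
      have h2 := (this.tendsto 0).mono_left (nhdsWithin_le_nhds (s := Ioi 0))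
      simpa using h2
    filter_upwards [h1.eventually (lt_mem_nhds hn)] with k hk
    linarith
  obtain ⟨k₀, hk₀, hk₀'⟩ := (hsmall.and self_mem_nhdsWithin).exists
  have hpos : 0 < k₀ := hk₀'
  set k₁ := max k₀ (measureUnivNNReal μ)
  have hcont : ContinuousOn (fun k => ‖expKernelOp μ k‖ - 2 * k) (Icc k₀ k₁) :=
    ((continuousOn_expKernelOp hpos).mono Icc_subset_Ici_self).norm.sub (by fun_prop)
  have hle : k₀ ≤ k₁ := le_max_left _ _
  have hmem : (0 : ℝ) ∈ Icc (‖expKernelOp μ k₁‖ - 2 * k₁) (‖expKernelOp μ k₀‖ - 2 * k₀) := by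
    constructor
    · have h1 := norm_expKernelOp_le (μ := μ) k₁
      have h2 : (measureUnivNNReal μ : ℝ) ≤ k₁ := le_max_right _ _
      linarith
    · have := le_norm_expKernelOp (μ := μ) hpos.le hn
      linarith
  obtain ⟨k, hk, hk'⟩ := intermediate_value_Icc' hle hcont hmem
  exact ⟨k, hpos.trans_le hk.1, by simpa [sub_eq_zero] using hk'⟩

/-- The norm of the integral operator is an eigenvalue with a nonnegative eigenfunction. -/
theorem exists_nonneg_eigenfunction (k : ℝ) (hS : 0 < ‖expKernelOp μ k‖) :
    ∃ z : Lp ℝ 2 μ, z ≠ 0 ∧ (∀ᵐ x ∂μ, 0 ≤ z x) ∧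
      expKernelOp μ k z = ‖expKernelOp μ k‖ • z := by
  set S := expKernelOp μ k
  set r := ‖S‖
  have : Fact ((2 : ENNReal) ≠ ⊤) := ⟨by norm_num⟩
  obtain ⟨u, hu1, hu⟩ := exists_norm_apply_eq_opNorm S (tendsto_expKernelOp_of_weak k)
  -- The kernel is positive, so `|S u| ≤ S |u|` pointwise and `|u|` attains the norm as well.
  set w : Lp ℝ 2 μ := |u|
  have hw : w =ᵐ[μ] fun x => |u x| := Lp.coeFn_abs u
  have hwn : ‖w‖ = ‖u‖ := norm_abs_eq_norm u
  have hSw : S w =ᵐ[μ] fun x => ∫ y, Real.exp (-(|k| * |x - y|)) * |u y| ∂μ := by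
    filter_upwards [coeFn_expKernelOp k w] with x hx
    rw [hx]
    refine integral_congr_ae ?_
    filter_upwards [hw] with y hy
    rw [hy]
  have hge : r ≤ ‖S w‖ := by
    refine hu.ge.trans ?_
    refine Lp.norm_le_norm_of_ae_le ?_
    filter_upwards [hSw, coeFn_expKernelOp k u] with x h1 h2
    rw [h1, h2, Real.norm_eq_abs, Real.norm_eq_abs]
    refine le_trans (abs_integral_le_integral_abs.trans (le_of_eq ?_)) (le_abs_self _)
    congr 1; ext y; rw [abs_mul, Real.abs_exp]
  have hle : ‖S w‖ ≤ r * ‖w‖ := S.le_opNorm w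
  have hw1 : ‖w‖ = 1 := by
    refine le_antisymm (hwn ▸ hu1) ?_
    nlinarith
  have hSw1 : ‖S w‖ = r := le_antisymm (by rwa [hw1, mul_one] at hle) hge
  -- As `⟨S²w, w⟩ = ‖S w‖² = r²`, expanding gives `‖S²w - r²w‖² = ‖S²w‖² - r⁴ ≤ 0`.
  have hSSw : S (S w) = r ^ 2 • w := by
    rw [← sub_eq_zero, ← norm_eq_zero, ← sq_eq_zero_iff]
    refine le_antisymm ?_ (sq_nonneg _)
    rw [norm_sub_sq_real, norm_smul, inner_smul_right, inner_expKernelOp_left,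
      real_inner_self_eq_norm_sq, hSw1, hw1, Real.norm_of_nonneg (by positivity)]
    have h1 : ‖S (S w)‖ ≤ r * r := (S.le_opNorm _).trans (by rw [hSw1])
    nlinarith [norm_nonneg (S (S w))]
  have hw0 : ∀ᵐ x ∂μ, 0 ≤ w x := by
    filter_upwards [hw] with x hx
    rw [hx]; exact abs_nonneg _
  have hSw0 : ∀ᵐ x ∂μ, 0 ≤ S w x := by
    filter_upwards [hSw] with x hx
    rw [hx]
    exact integral_nonneg fun y => by positivity
  have hsum : ((r • w + S w : Lp ℝ 2 μ) : ℝ → ℝ) =ᵐ[μ] fun x => r * w x + S w x := by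
    filter_upwards [Lp.coeFn_add (r • w) (S w), Lp.coeFn_smul r w] with x h1 h2
    rw [h1, Pi.add_apply, h2, Pi.smul_apply, smul_eq_mul]
  -- From `(S - r)(S + r) w = 0`, the vector `(S + r) w` is an eigenvector for `+r`; both summands
  -- are nonnegative, so they cannot cancel.
  refine ⟨r • w + S w, fun h => ?_, ?_, ?_⟩
  · have h1 : ‖r • w‖ ≤ ‖r • w + S w‖ := by
      refine Lp.norm_le_norm_of_ae_le ?_
      filter_upwards [hsum, Lp.coeFn_smul r w, hw0, hSw0] with x h1 h2 h3 h4
      rw [h1, h2, Pi.smul_apply, smul_eq_mul, Real.norm_of_nonneg (by positivity),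
        Real.norm_of_nonneg (by positivity)]
      linarith
    rw [h, norm_zero, norm_smul, hw1, Real.norm_of_nonneg hS.le] at h1
    linarith
  · filter_upwards [hsum, hw0, hSw0] with x h1 h3 h4
    rw [h1]; positivity
  · rw [map_add, map_smul, hSSw, smul_add, smul_smul, sq, add_comm]

end ExpKernel

/-! ### The positive solution of `u'' = (k² - q) u`. -/

theorem integrable_exp_neg_mul_abs {k : ℝ} (hk : 0 < k) :
    Integrable (fun x : ℝ => Real.exp (-(k * |x|))) := by
  rw [← integrableOn_univ, ← Iic_union_Ioi (a := (0 : ℝ)), integrableOn_union]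
  constructor
  · refine (integrableOn_exp_mul_Iic hk 0).congr_fun (fun x hx => ?_) measurableSet_Iic
    simp only
    rw [abs_of_nonpos hx]; congr 1; ring
  · refine (exp_neg_integrableOn_Ioi 0 hk).congr_fun (fun x hx => ?_) measurableSet_Ioi
    simp only
    rw [abs_of_pos hx]; congr 1; ring

theorem integrable_expKernelIntegral {p : ℝ → ℝ} (hp : Integrable p) {k : ℝ} (hk : 0 < k) :
    Integrable (expKernelIntegral volume k p) := by
  have h := hp.integrable_convolution (ContinuousLinearMap.mul ℝ ℝ)
    (integrable_exp_neg_mul_abs hk)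
  refine h.congr (Eventually.of_forall fun x => ?_)
  simp only [convolution_def, ContinuousLinearMap.mul_apply', expKernelIntegral]
  rw [abs_of_pos hk]
  congr 1; ext y; ring

/-- The convolution is bounded and integrable, hence square integrable. -/
theorem memLp_two_expKernelIntegral {p : ℝ → ℝ} (hp : Integrable p) {k : ℝ} (hk : 0 < k) :
    MemLp (expKernelIntegral volume k p) 2 := by
  have hc := continuous_expKernelIntegral hp k
  rw [memLp_two_iff_integrable_sq hc.aestronglyMeasurable]
  have := (integrable_expKernelIntegral hp hk).bdd_mul (c := ∫ y, |p y|)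
    hc.aestronglyMeasurable (Eventually.of_forall fun x => abs_expKernelIntegral_le hp k x)
  simpa only [sq] using this

/-- The convolution `U` of `exp (-k |x|)` with an integrable function `p ≥ 0` is `C¹`, its
derivative is absolutely continuous with `U'' = k² U - 2 k p`, and `|U'| ≤ k U`. -/
theorem exists_deriv_expKernelIntegral {p : ℝ → ℝ} (hp : Integrable p) (hp0 : ∀ᵐ x, 0 ≤ p x)
    {k : ℝ} (hk : 0 < k) :
    ∃ U' : ℝ → ℝ, (∀ x, HasDerivAt (expKernelIntegral volume k p) (U' x) x) ∧
      (∀ x y, U' y - U' x =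
        ∫ t in x..y, (k ^ 2 * expKernelIntegral volume k p t - 2 * k * p t)) ∧
      ∀ x, |U' x| ≤ k * expKernelIntegral volume k p x := by
  set U := expKernelIntegral volume k p
  have hcont := continuous_expKernelIntegral hp k
  have hpl : ∀ c : ℝ, LocallyIntegrable (fun y => Real.exp (c * y) * p y) := fun c =>
    hp.locallyIntegrable.continuous_smul (show Continuous fun y => Real.exp (c * y) by fun_prop)
  have hIic : ∀ x, IntegrableOn (fun y => Real.exp (k * y) * p y) (Iic x) := fun x => by
    refine hp.integrableOn.bdd_mul (c := Real.exp (k * x)) (by fun_prop) ?_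
    refine (ae_restrict_iff' measurableSet_Iic).2 (Eventually.of_forall fun y hy => ?_)
    rw [Real.norm_eq_abs, Real.abs_exp]
    have : y ≤ x := hy
    gcongr
  have hIoi : ∀ x, IntegrableOn (fun y => Real.exp (-k * y) * p y) (Ioi x) := fun x => by
    refine hp.integrableOn.bdd_mul (c := Real.exp (-k * x)) (by fun_prop) ?_
    refine (ae_restrict_iff' measurableSet_Ioi).2 (Eventually.of_forall fun y hy => ?_)
    rw [Real.norm_eq_abs, Real.abs_exp]
    have : x < y := hy
    refine Real.exp_le_exp.2 ?_
    nlinarith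
  set I : ℝ → ℝ := fun x => ∫ y in Iic x, Real.exp (k * y) * p y with hI
  set J : ℝ → ℝ := fun x => ∫ y in Ioi x, Real.exp (-k * y) * p y with hJ
  have hIp : ∀ x y, I y - I x = ∫ t in x..y, Real.exp (k * t) * p t := fun x y =>
    intervalIntegral.integral_Iic_sub_Iic (hIic x) (hIic y)
  have hJp : ∀ x y, J y - J x = ∫ t in x..y, -(Real.exp (-k * t) * p t) := fun x y => by
    rw [intervalIntegral.integral_neg, ← intervalIntegral.integral_Ioi_sub_Ioi' (hIoi x) (hIoi y)]
    ring
  have hexp : ∀ c x : ℝ, HasDerivAt (fun x => Real.exp (c * x)) (c * Real.exp (c * x)) x :=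
    fun c x => by
      have := ((hasDerivAt_id x).const_mul c).exp
      simpa [mul_comm] using this
  -- Splitting the convolution at `y = x` gives `U = A + B` with `A' = p - k A` and `B' = k B - p`
  -- almost everywhere. Hence `U' = k (B - A)`, and `A, B ≥ 0` gives `|U'| ≤ k U`.
  set A : ℝ → ℝ := fun x => I x * Real.exp (-k * x) with hA
  set B : ℝ → ℝ := fun x => J x * Real.exp (k * x) with hB
  have hIc : Continuous I := continuous_of_primitive (hpl k) hIp
  have hJc : Continuous J := continuous_of_primitive (hpl (-k)).neg hJp
  have hAc : Continuous A := hIc.mul (by fun_prop)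
  have hBc : Continuous B := hJc.mul (by fun_prop)
  have hmul : ∀ t : ℝ, Real.exp (k * t) * Real.exp (-k * t) = 1 := fun t => by
    rw [← Real.exp_add]; simp
  have hAp : ∀ x y, A y - A x = ∫ t in x..y, (p t - k * A t) := fun x y => by
    rw [← integral_mul_add_mul_eq_sub_of_primitive (hpl k) hIp (hexp (-k)) (by fun_prop)]
    congr 1; ext t
    simp only [hA]
    linear_combination (p t) * hmul t
  have hBp : ∀ x y, B y - B x = ∫ t in x..y, (k * B t - p t) := fun x y => by
    rw [← integral_mul_add_mul_eq_sub_of_primitive (hpl (-k)).neg hJp (hexp k) (by fun_prop)]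
    congr 1; ext t
    simp only [hB, Pi.neg_apply]
    linear_combination (-(p t)) * hmul t
  have hpi : ∀ x y, IntervalIntegrable p volume x y := fun x y => hp.intervalIntegrable
  have hAi : ∀ x y, IntervalIntegrable (fun t => p t - k * A t) volume x y := fun x y =>
    (hpi x y).sub ((continuous_const.mul hAc).intervalIntegrable x y)
  have hBi : ∀ x y, IntervalIntegrable (fun t => k * B t - p t) volume x y := fun x y =>
    ((continuous_const.mul hBc).intervalIntegrable x y).sub (hpi x y)
  have hU : ∀ x, U x = A x + B x := fun x => by
    have hint := integrable_exp_kernel_mul hp k x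
    have e1 : A x = ∫ y in Iic x, Real.exp (-(|k| * |x - y|)) * p y := by
      change (∫ y in Iic x, Real.exp (k * y) * p y) * Real.exp (-k * x) = _
      rw [← integral_mul_const]
      refine setIntegral_congr_fun measurableSet_Iic fun y hy => ?_
      have : y ≤ x := hy
      rw [abs_of_pos hk, abs_of_nonneg (by linarith : 0 ≤ x - y),
        show -(k * (x - y)) = k * y + -k * x by ring, Real.exp_add]
      ring
    have e2 : B x = ∫ y in Ioi x, Real.exp (-(|k| * |x - y|)) * p y := by
      change (∫ y in Ioi x, Real.exp (-k * y) * p y) * Real.exp (k * x) = _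
      rw [← integral_mul_const]
      refine setIntegral_congr_fun measurableSet_Ioi fun y hy => ?_
      have : x < y := hy
      rw [abs_of_pos hk, abs_of_nonpos (by linarith : x - y ≤ 0),
        show -(k * -(x - y)) = -k * y + k * x by ring, Real.exp_add]
      ring
    rw [e1, e2, intervalIntegral.integral_Iic_add_Ioi hint.integrableOn hint.integrableOn]
    rfl
  have hA0 : ∀ x, 0 ≤ A x := fun x =>
    mul_nonneg (integral_nonneg_of_ae (ae_restrict_of_ae (hp0.mono fun y hy => by
      simp only [Pi.zero_apply]; positivity))) (Real.exp_pos _).le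
  have hB0 : ∀ x, 0 ≤ B x := fun x =>
    mul_nonneg (integral_nonneg_of_ae (ae_restrict_of_ae (hp0.mono fun y hy => by
      simp only [Pi.zero_apply]; positivity))) (Real.exp_pos _).le
  have hUp : ∀ x y, U y - U x = ∫ t in x..y, k * (B t - A t) := fun x y => by
    rw [hU, hU, show A y + B y - (A x + B x) = (A y - A x) + (B y - B x) by ring, hAp, hBp,
      ← intervalIntegral.integral_add (hAi x y) (hBi x y)]
    congr 1; ext t; ring
  have hBAc : Continuous fun t => k * (B t - A t) := continuous_const.mul (hBc.sub hAc)
  refine ⟨fun x => k * (B x - A x), fun x => ?_, fun x y => ?_, fun x => ?_⟩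
  · have h := (intervalIntegral.integral_hasDerivAt_right (hBAc.intervalIntegrable 0 x)
      (hBAc.stronglyMeasurableAtFilter _ _) hBAc.continuousAt).const_add (U 0)
    rwa [← show U = fun x => U 0 + ∫ t in (0 : ℝ)..x, k * (B t - A t) from
      funext fun x => by rw [← hUp 0 x]; ring] at h
  · rw [show k * (B y - A y) - k * (B x - A x) = k * ((B y - B x) - (A y - A x)) by ring, hAp, hBp,
      ← intervalIntegral.integral_sub (hBi x y) (hAi x y), ← intervalIntegral.integral_const_mul]
    congr 1; ext t
    rw [hU]; ring
  · rw [hU, abs_mul, abs_of_pos hk]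
    refine mul_le_mul_of_nonneg_left ?_ hk.le
    rw [abs_le]
    constructor <;> linarith [hA0 x, hB0 x]

/-- For a nonzero integrable `q ≥ 0`, some `-k² < 0` is an eigenvalue of `-∂² - q`
with a positive eigenfunction `u` such that `|u'| ≤ k u`. -/
theorem exists_positive_eigenfunction {q : ℝ → ℝ≥0} (hq : Measurable q)
    (hqi : Integrable fun x => (q x : ℝ)) (hq0 : ¬ ∀ᵐ x, q x = 0) :
    ∃ (k : ℝ) (u u' : ℝ → ℝ), 0 < k ∧ (∀ x, HasDerivAt u (u' x) x) ∧
      (∀ x y, u' y - u' x = ∫ t in x..y, (k ^ 2 * u t - q t * u t)) ∧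
      (∀ x, 0 < u x) ∧ (∀ x, |u' x| ≤ k * u x) ∧ MemLp u 2 volume := by
  set μ : Measure ℝ := volume.withDensity fun x => (q x : ENNReal) with hμdef
  have : IsFiniteMeasure μ := by
    refine isFiniteMeasure_withDensity ?_
    have := hqi.2
    rw [HasFiniteIntegral] at this
    simpa using this.ne
  have hμ : μ ≠ 0 := fun h => hq0 (by
    rw [hμdef, withDensity_eq_zero_iff (by fun_prop)] at h
    filter_upwards [h] with x hx
    simpa using hx)
  obtain ⟨k, hk, hk2⟩ := exists_norm_expKernelOp_eq hμ
  obtain ⟨z, hz, hz0, hzS⟩ := exists_nonneg_eigenfunction (μ := μ) k (by rw [hk2]; linarith)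
  have hzi := integrable_of_L2 z
  -- The class `z` carries no information where `q = 0`; the eigenvalue equation extends it to a
  -- function `u` defined at every point.
  set u : ℝ → ℝ := fun x => (2 * k)⁻¹ * expKernelIntegral μ k z x with hu
  have hzu : ∀ᵐ x ∂μ, z x = u x := by
    have h1 := coeFn_expKernelOp k z
    rw [hzS, hk2] at h1
    filter_upwards [h1, Lp.coeFn_smul (2 * k) z] with x h2 h3
    rw [h3, Pi.smul_apply, smul_eq_mul] at h2
    rw [hu]
    simp only
    rw [← h2]; field_simp
  have hui : Integrable u μ := hzi.congr hzu
  have hpi : Integrable (fun x => (q x : ℝ) * u x) :=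
    (integrable_withDensity_iff_integrable_smul hq).1 hui
  have hukey : ∀ x, u x = (2 * k)⁻¹ * expKernelIntegral volume k (fun y => q y * u y) x :=
    fun x => by
      have e : expKernelIntegral μ k z x = expKernelIntegral μ k u x := by
        refine integral_congr_ae ?_
        filter_upwards [hzu] with y hy
        rw [hy]
      have e' : expKernelIntegral μ k u x
          = expKernelIntegral volume k (fun y => q y * u y) x := by
        refine (integral_withDensity_eq_integral_smul hq _).trans ?_
        refine integral_congr_ae (Eventually.of_forall fun y => ?_)
        simp only [NNReal.smul_def, smul_eq_mul]; ring
      rw [← e', ← e]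
  have hpos : ∀ x, 0 < u x := fun x => by
    refine mul_pos (by positivity) ?_
    rw [expKernelIntegral, integral_pos_iff_support_of_nonneg_ae
      (hz0.mono fun y hy => by simp only [Pi.zero_apply]; positivity)
      (integrable_exp_kernel_mul hzi k x)]
    rw [pos_iff_ne_zero]
    -- A vanishing integral would force `z = 0` almost everywhere for `μ`, the kernel being strictly
    -- positive.
    intro h
    apply hz
    rw [Lp.eq_zero_iff_ae_eq_zero]
    have h' : ∀ᵐ y ∂μ, Real.exp (-(|k| * |x - y|)) * z y = 0 := by
      rw [ae_iff]; exact h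
    filter_upwards [h'] with y hy
    exact (mul_eq_zero.1 hy).resolve_left (Real.exp_ne_zero _)
  set U := expKernelIntegral volume k (fun y => q y * u y)
  have hUu : u = fun x => (2 * k)⁻¹ * U x := funext hukey
  obtain ⟨U', hU1, hU2, hU3⟩ := exists_deriv_expKernelIntegral hpi
    (Eventually.of_forall fun x => mul_nonneg (q x).2 (hpos x).le) hk
  refine ⟨k, u, fun x => (2 * k)⁻¹ * U' x, hk, fun x => ?_, fun x y => ?_, hpos, fun x => ?_, ?_⟩
  · rw [hUu]; exact (hU1 x).const_mul _
  · rw [← mul_sub, hU2, ← intervalIntegral.integral_const_mul]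
    congr 1; ext t
    rw [hukey t]
    simp only [U]
    field_simp
  · rw [abs_mul, abs_of_pos (by positivity), hukey]
    have := hU3 x
    calc (2 * k)⁻¹ * |U' x| ≤ (2 * k)⁻¹ * (k * U x) := by gcongr
      _ = k * ((2 * k)⁻¹ * U x) := by ring
  · rw [hUu]; exact (memLp_two_expKernelIntegral hpi hk).const_mul _

/-! ### The lower bound on the energy. -/

theorem locallyIntegrable_clm_comp (L : ℂ →L[ℝ] ℝ) {f : ℝ → ℂ}
    (hf : LocallyIntegrable f volume) : LocallyIntegrable (fun x => L (f x)) volume := fun x =>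
  let ⟨s, hs, hi⟩ := hf x
  ⟨s, hs, L.integrable_comp hi⟩

/-- A real component of an element of the domain of `-∂² + W` has a `C¹` representative with
absolutely continuous derivative. -/
theorem IsSchrodingerImage.exists_C1_representative {W : ℝ → ℝ} {ψ φ : L2R}
    (h : IsSchrodingerImage W ψ φ) (L : ℂ →L[ℝ] ℝ) :
    ∃ b b' : ℝ → ℝ, (∀ᵐ x, L (ψ x) = b x) ∧ (∀ x, HasDerivAt b (b' x) x) ∧
      LocallyIntegrable (fun x => W x * L (ψ x) - L (φ x)) volume ∧
      ∀ x y, b' y - b' x = ∫ t in x..y, (W t * L (ψ t) - L (φ t)) := by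
  have hψ := ψ.locallyIntegrable
  have hφ := φ.locallyIntegrable
  have hW : LocallyIntegrable (fun x => W x * L (ψ x)) volume := by
    have := locallyIntegrable_clm_comp L h.1
    simpa only [map_smul, smul_eq_mul] using this
  have hg : LocallyIntegrable (fun x => W x * L (ψ x) - L (φ x)) volume :=
    hW.sub (locallyIntegrable_clm_comp L hφ)
  obtain ⟨b, b', h1, h2, h3⟩ := _root_.exists_C1_representative
    (locallyIntegrable_clm_comp L hψ) hg (fun η hη hc => by
      have hηc := hη.continuous
      have i1 := integrable_test_smul (continuous_neg_iteratedDeriv_two hη)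
        (hasCompactSupport_neg_iteratedDeriv_two hc) hψ
      have i2 := integrable_test_smul hηc hc h.1
      have i3 := integrable_test_smul hηc hc hφ
      have j2 : Integrable (fun x => η x * (W x * L (ψ x))) :=
        hW.integrable_smul_left_of_hasCompactSupport hηc hc
      have j3 : Integrable (fun x => η x * L (φ x)) :=
        (locallyIntegrable_clm_comp L hφ).integrable_smul_left_of_hasCompactSupport hηc hc
      have key := congrArg L (h.2 η hη hc)
      rw [map_add, ← L.integral_comp_comm i1, ← L.integral_comp_comm i2,
        ← L.integral_comp_comm i3] at key
      simp only [map_smul, smul_eq_mul, neg_mul] at key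
      rw [integral_neg] at key
      simp only [mul_sub]
      rw [integral_sub j2 j3]
      linarith)
  exact ⟨b, b', h1, h2, hg, h3⟩

/-- The ground state transformation on a bounded interval. -/
theorem boundary_le_integral {k : ℝ} {q u u' W a b b' h : ℝ → ℝ}
    (hq : LocallyIntegrable q volume) (hWq : ∀ᵐ x, W x = -q x)
    (hu : ∀ x, HasDerivAt u (u' x) x)
    (hu' : ∀ x y, u' y - u' x = ∫ t in x..y, (k ^ 2 * u t - q t * u t)) (hpos : ∀ x, 0 < u x)
    (hab : ∀ᵐ x, a x = b x) (hb : ∀ x, HasDerivAt b (b' x) x)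
    (hg : LocallyIntegrable (fun x => W x * a x - h x) volume)
    (hb' : ∀ x y, b' y - b' x = ∫ t in x..y, (W t * a t - h t))
    (hh : LocallyIntegrable h volume) {s t : ℝ} (hst : s ≤ t) :
    (u' t * (b t ^ 2 / u t) - b' t * b t) - (u' s * (b s ^ 2 / u s) - b' s * b s) ≤
      ∫ x in s..t, (k ^ 2 * b x ^ 2 + h x * b x) := by
  have huc : Continuous u := continuous_iff_continuousAt.2 fun x => (hu x).continuousAt
  have hbc : Continuous b := continuous_iff_continuousAt.2 fun x => (hb x).continuousAt
  have hqu : LocallyIntegrable (fun x => q x * u x) volume := by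
    have := hq.continuous_smul huc
    simpa only [smul_eq_mul, mul_comm] using this
  have hf : LocallyIntegrable (fun t => k ^ 2 * u t - q t * u t) volume :=
    (continuous_const.mul huc).locallyIntegrable.sub hqu
  have hu'c := continuous_of_primitive hf hu'
  have hb'c := continuous_of_primitive hg hb'
  have hne : ∀ x, u x ≠ 0 := fun x => (hpos x).ne'
  have hder : ∀ x, HasDerivAt (fun x => b x ^ 2 / u x)
      ((2 * b x * b' x * u x - b x ^ 2 * u' x) / u x ^ 2) x := fun x => by
    refine (((hb x).pow 2).div (hu x) (hne x)).congr_deriv ?_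
    simp
  have hc1 : Continuous fun x => (2 * b x * b' x * u x - b x ^ 2 * u' x) / u x ^ 2 :=
    Continuous.div (by fun_prop) (by fun_prop) fun x => pow_ne_zero 2 (hne x)
  have hc2 : Continuous fun x => b x ^ 2 / u x := Continuous.div (by fun_prop) huc hne
  have e1 := integral_mul_add_mul_eq_sub_of_primitive hf hu' hder hc1 s t
  have e2 := integral_mul_add_mul_eq_sub_of_primitive hg hb' hb hb'c s t
  have i1 : IntervalIntegrable (fun x => (k ^ 2 * u x - q x * u x) * (b x ^ 2 / u x) +
      u' x * ((2 * b x * b' x * u x - b x ^ 2 * u' x) / u x ^ 2)) volume s t :=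
    ((hf.intervalIntegrable' s t).mul_continuousOn hc2.continuousOn).add
      ((hu'c.mul hc1).intervalIntegrable s t)
  have i2 : IntervalIntegrable (fun x => (W x * a x - h x) * b x + b' x * b' x) volume s t :=
    ((hg.intervalIntegrable' s t).mul_continuousOn hbc.continuousOn).add
      ((hb'c.mul hb'c).intervalIntegrable s t)
  have i3 : IntervalIntegrable (fun x => k ^ 2 * b x ^ 2 + h x * b x) volume s t :=
    ((continuous_const.mul (hbc.pow 2)).intervalIntegrable s t).add
      ((hh.intervalIntegrable' s t).mul_continuousOn hbc.continuousOn)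
  calc _ = (u' t * (b t ^ 2 / u t) - u' s * (b s ^ 2 / u s)) - (b' t * b t - b' s * b s) := by ring
    _ = _ := by rw [← e1, ← e2, ← intervalIntegral.integral_sub i1 i2]
    _ ≤ _ := by
      refine intervalIntegral.integral_mono_ae hst (i1.sub i2) i3 ?_
      filter_upwards [hab, hWq] with x h1 h2
      rw [h1, h2, ← sub_nonneg]
      have hx := hne x
      -- Jacobi's identity: the potential cancels and a perfect square remains.
      have : k ^ 2 * b x ^ 2 + h x * b x -
          ((k ^ 2 * u x - q x * u x) * (b x ^ 2 / u x) +
            u' x * ((2 * b x * b' x * u x - b x ^ 2 * u' x) / u x ^ 2) -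
            ((-q x * b x - h x) * b x + b' x * b' x)) = (b' x - u' x * b x / u x) ^ 2 := by
        field_simp
        ring
      rw [this]
      positivity

/-- For an integrable `C¹` function `g ≥ 0` and a bounded function `v`, the quantity
`v g - g' / 2` cannot stay below a negative number near `+∞`. -/
theorem exists_ge_neg_le_boundary {g g' v : ℝ → ℝ} {k ε : ℝ} (hg0 : ∀ x, 0 ≤ g x)
    (hgi : Integrable g) (hg : ∀ x, HasDerivAt g (g' x) x) (hv : ∀ x, |v x| ≤ k) (hε : 0 < ε)
    (N : ℝ) : ∃ x ≥ N, -ε ≤ v x * g x - g' x / 2 := by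
  by_contra! hcon
  have hk : 0 ≤ k := (abs_nonneg _).trans (hv 0)
  have hgc : Continuous g := continuous_iff_continuousAt.2 fun x => (hg x).continuousAt
  -- If the claim fails, `g' > 2ε + 2 v g ≥ 2ε - 2k g` beyond `N`, so `H` is nondecreasing there. As
  -- `∫ g` is finite, `g` then grows at least linearly, which contradicts integrability.
  set H : ℝ → ℝ := fun x => g x - 2 * ε * x + 2 * k * ∫ t in N..x, g t with hH
  have hHd : ∀ x, HasDerivAt H (g' x - 2 * ε + 2 * k * g x) x := fun x => by
    have h1 := intervalIntegral.integral_hasDerivAt_right (hgc.intervalIntegrable N x)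
      (hgc.stronglyMeasurableAtFilter _ _) hgc.continuousAt
    have h2 := ((hg x).sub ((hasDerivAt_id x).const_mul (2 * ε))).add (h1.const_mul (2 * k))
    rw [mul_one] at h2
    exact h2
  have hmono : MonotoneOn H (Ici N) := by
    refine monotoneOn_of_deriv_nonneg (convex_Ici N)
      (fun x _ => (hHd x).continuousAt.continuousWithinAt)
      (fun x _ => (hHd x).differentiableAt.differentiableWithinAt) fun x hx => ?_
    rw [interior_Ici] at hx
    rw [(hHd x).deriv]
    have h1 := hcon x (le_of_lt hx)
    have h2 : -k ≤ v x := (abs_le.1 (hv x)).1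
    nlinarith [hg0 x]
  set C := ∫ x, g x
  have hlow : ∀ x ≥ N, 2 * ε * (x - N) - 2 * k * C ≤ g x := fun x hx => by
    have h1 := hmono self_mem_Ici hx hx
    simp only [hH, intervalIntegral.integral_same] at h1
    have h2 : ∫ t in N..x, g t ≤ C := by
      rw [intervalIntegral.integral_of_le hx]
      exact setIntegral_le_integral hgi (Eventually.of_forall hg0)
    have h3 : 2 * k * ∫ t in N..x, g t ≤ 2 * k * C := by gcongr
    nlinarith [hg0 N]
  have hfin := hgi.measure_norm_ge_lt_top one_pos
  set M := max N (N + (1 + 2 * k * C) / (2 * ε))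
  have hsub : Ici M ⊆ {x | (1 : ℝ) ≤ ‖g x‖} := fun x hx => by
    have h1 : N ≤ x := (le_max_left _ _).trans hx
    have h2 : N + (1 + 2 * k * C) / (2 * ε) ≤ x := (le_max_right _ _).trans hx
    have h3 : (1 + 2 * k * C) / (2 * ε) ≤ x - N := by linarith
    rw [div_le_iff₀ (by positivity)] at h3
    have h4 := hlow x h1
    rw [mem_ofPred_eq, Real.norm_of_nonneg (hg0 x)]
    linarith
  have := (measure_mono hsub).trans_lt hfin
  simp at this

/-- The real and imaginary parts satisfy the interval inequality separately. Added up, they involve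
only `g = |ψ|²` and the boundary function `P = (u'/u) g - g'/2`, to which the endpoint lemma applies
at both ends. -/
theorem neg_sq_norm_le_inner {k : ℝ} {q u u' W : ℝ → ℝ}
    (hq : LocallyIntegrable q volume) (hWq : ∀ᵐ x, W x = -q x)
    (hu : ∀ x, HasDerivAt u (u' x) x)
    (hu' : ∀ x y, u' y - u' x = ∫ t in x..y, (k ^ 2 * u t - q t * u t)) (hpos : ∀ x, 0 < u x)
    (huk : ∀ x, |u' x| ≤ k * u x) {ψ φ : L2R} (h : IsSchrodingerImage W ψ φ) :
    -(k ^ 2) * ‖ψ‖ ^ 2 ≤ (inner ℂ ψ φ).re := by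
  have hψ := Lp.memLp ψ
  have hφ := Lp.memLp φ
  obtain ⟨b₁, b₁', ha₁, hb₁, hg₁, hb₁'⟩ := h.exists_C1_representative Complex.reCLM
  obtain ⟨b₂, b₂', ha₂, hb₂, hg₂, hb₂'⟩ := h.exists_C1_representative Complex.imCLM
  set h₁ : ℝ → ℝ := fun x => Complex.reCLM (φ x)
  set h₂ : ℝ → ℝ := fun x => Complex.imCLM (φ x)
  have hh₁ : LocallyIntegrable h₁ volume := locallyIntegrable_clm_comp _ φ.locallyIntegrable
  have hh₂ : LocallyIntegrable h₂ volume := locallyIntegrable_clm_comp _ φ.locallyIntegrable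
  have hb₁c : Continuous b₁ := continuous_iff_continuousAt.2 fun x => (hb₁ x).continuousAt
  have hb₂c : Continuous b₂ := continuous_iff_continuousAt.2 fun x => (hb₂ x).continuousAt
  set g : ℝ → ℝ := fun x => b₁ x ^ 2 + b₂ x ^ 2 with hgdef
  set g' : ℝ → ℝ := fun x => 2 * (b₁' x * b₁ x + b₂' x * b₂ x) with hg'def
  have hgd : ∀ x, HasDerivAt g (g' x) x := fun x => by
    have := ((hb₁ x).pow 2).add ((hb₂ x).pow 2)
    refine this.congr_deriv ?_
    simp only [hg'def]; push_cast; ring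
  have hg0 : ∀ x, 0 ≤ g x := fun x => by positivity
  have hgψ : (fun x => ‖ψ x‖ ^ 2) =ᵐ[volume] g := by
    filter_upwards [ha₁, ha₂] with x h1 h2
    rw [hgdef]
    simp only
    rw [← h1, ← h2, Complex.sq_norm, Complex.normSq_apply]
    simp only [Complex.reCLM_apply, Complex.imCLM_apply]; ring
  have hgi : Integrable g := hψ.integrable_norm_pow (by norm_num) |>.congr hgψ
  have hin : (fun x => (inner ℂ (ψ x) (φ x)).re) =ᵐ[volume]
      fun x => h₁ x * b₁ x + h₂ x * b₂ x := by
    filter_upwards [ha₁, ha₂] with x h1 h2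
    rw [← h1, ← h2]
    simp [h₁, h₂]
  have hii : Integrable (fun x => inner ℂ (ψ x) (φ x)) := L2.integrable_inner ψ φ
  have hinI : Integrable fun x => h₁ x * b₁ x + h₂ x * b₂ x := hii.re.congr hin
  set J : ℝ → ℝ := fun x => k ^ 2 * g x + (h₁ x * b₁ x + h₂ x * b₂ x) with hJdef
  have hJ : Integrable J := (hgi.const_mul _).add hinI
  have hJint : ∫ x, J x = k ^ 2 * ‖ψ‖ ^ 2 + (inner ℂ ψ φ).re := by
    have e1 : ∫ x, g x = ‖ψ‖ ^ 2 := by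
      have h1 := inner_self_eq_norm_sq (𝕜 := ℂ) ψ
      rw [← h1, L2.inner_def]
      have h2 : RCLike.re (∫ x, inner ℂ (ψ x) (ψ x)) = ∫ x, RCLike.re (inner ℂ (ψ x) (ψ x)) :=
        (integral_re (L2.integrable_inner ψ ψ)).symm
      rw [h2]
      refine integral_congr_ae ?_
      filter_upwards [hgψ] with x hx
      rw [← hx, inner_self_eq_norm_sq (𝕜 := ℂ)]
    have e2 : ∫ x, (h₁ x * b₁ x + h₂ x * b₂ x) = (inner ℂ ψ φ).re := by
      rw [L2.inner_def, ← integral_congr_ae hin]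
      exact integral_re hii
    rw [hJdef, integral_add (hgi.const_mul _) hinI, integral_const_mul, e1, e2]
  set v : ℝ → ℝ := fun x => u' x / u x with hvdef
  have hv : ∀ x, |v x| ≤ k := fun x => by
    rw [hvdef, abs_div, abs_of_pos (hpos x), div_le_iff₀ (hpos x)]
    exact huk x
  set P : ℝ → ℝ := fun x => v x * g x - g' x / 2 with hP
  have hPJ : ∀ s t, s ≤ t → P t - P s ≤ ∫ x in s..t, J x := fun s t hst => by
    have k1 := boundary_le_integral hq hWq hu hu' hpos ha₁ hb₁ hg₁ hb₁' hh₁ hst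
    have k2 := boundary_le_integral hq hWq hu hu' hpos ha₂ hb₂ hg₂ hb₂' hh₂ hst
    have i1 : IntervalIntegrable (fun x => k ^ 2 * b₁ x ^ 2 + h₁ x * b₁ x) volume s t :=
      ((continuous_const.mul (hb₁c.pow 2)).intervalIntegrable s t).add
        ((hh₁.intervalIntegrable' s t).mul_continuousOn hb₁c.continuousOn)
    have i2 : IntervalIntegrable (fun x => k ^ 2 * b₂ x ^ 2 + h₂ x * b₂ x) volume s t :=
      ((continuous_const.mul (hb₂c.pow 2)).intervalIntegrable s t).add
        ((hh₂.intervalIntegrable' s t).mul_continuousOn hb₂c.continuousOn)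
    have e : ∫ x in s..t, J x = (∫ x in s..t, (k ^ 2 * b₁ x ^ 2 + h₁ x * b₁ x)) +
        ∫ x in s..t, (k ^ 2 * b₂ x ^ 2 + h₂ x * b₂ x) := by
      rw [← intervalIntegral.integral_add i1 i2]
      congr 1; ext x; simp only [hJdef, hgdef]; ring
    rw [e]
    refine le_trans (le_of_eq ?_) (add_le_add k1 k2)
    simp only [hP, hvdef, hgdef, hg'def]
    ring
  have hε : ∀ ε > 0, -(2 * ε) ≤ ∫ x, J x := fun ε hε => by
    have hr := fun n : ℕ => exists_ge_neg_le_boundary hg0 hgi hgd hv hε (n : ℝ)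
    -- Reflection `x ↦ -x` reverses the sign of `P`, so the left endpoints satisfy `P(-s) ≤ ε` and
    -- the total boundary term is at least `-2ε`.
    have hl := fun n : ℕ => exists_ge_neg_le_boundary (g := fun x => g (-x))
      (g' := fun x => -g' (-x)) (v := fun x => -v (-x)) (k := k) (fun x => hg0 _) hgi.comp_neg
      (fun x => ((hgd (-x)).comp x (hasDerivAt_neg x)).congr_deriv (by simp))
      (fun x => by rw [abs_neg]; exact hv _) hε (n : ℝ)
    choose t ht htP using hr
    choose s hs hsP using hl
    have htl : Tendsto t atTop atTop := tendsto_atTop_mono ht tendsto_natCast_atTop_atTop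
    have hsl : Tendsto (fun n => -s n) atTop atBot :=
      tendsto_neg_atTop_atBot.comp (tendsto_atTop_mono hs tendsto_natCast_atTop_atTop)
    refine ge_of_tendsto' (intervalIntegral_tendsto_integral hJ hsl htl) fun n => ?_
    have hn : (0 : ℝ) ≤ n := n.cast_nonneg
    have h1 := hPJ (-s n) (t n) (by linarith [hs n, ht n])
    have h2 := htP n
    have h3 := hsP n
    simp only [hP] at h1
    linarith
  have : 0 ≤ ∫ x, J x := by
    refine le_of_forall_pos_le_add fun ε h0 => ?_
    have := hε (ε / 2) (by positivity)
    linarith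
  rw [hJint] at this
  linarith

/-! ### From the solution to the operator, and the conclusion. -/

/-- A positive solution of `u'' = (k² - q) u` in `L²` is an eigenfunction of `-∂² - q`. -/
theorem isSchrodingerImage_of_solution {k : ℝ} {q u u' W : ℝ → ℝ}
    (hq : LocallyIntegrable q volume) (hWq : ∀ᵐ x, W x = -q x)
    (hu : ∀ x, HasDerivAt u (u' x) x)
    (hu' : ∀ x y, u' y - u' x = ∫ t in x..y, (k ^ 2 * u t - q t * u t))
    (hu2 : MemLp (fun x => (u x : ℂ)) 2 volume) :
    IsSchrodingerImage W (hu2.toLp _) (((-(k ^ 2) : ℝ) : ℂ) • hu2.toLp _) := by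
  have huc : Continuous u := continuous_iff_continuousAt.2 fun x => (hu x).continuousAt
  have hqu : LocallyIntegrable (fun x => q x * u x) volume := by
    have := hq.continuous_smul huc
    simpa only [smul_eq_mul, mul_comm] using this
  have hf : LocallyIntegrable (fun t => k ^ 2 * u t - q t * u t) volume :=
    (continuous_const.mul huc).locallyIntegrable.sub hqu
  have hae := hu2.coeFn_toLp
  have hWae : ∀ᵐ x, W x • (hu2.toLp _ : L2R) x = ((-(q x * u x) : ℝ) : ℂ) := by
    filter_upwards [hae, hWq] with x h1 h2
    rw [h1, h2]; simp
  refine ⟨?_, fun η hη hc => ?_⟩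
  · have : LocallyIntegrable (fun x => ((-(q x * u x) : ℝ) : ℂ)) volume := fun x =>
      let ⟨s, hs, hi⟩ := hqu.neg x
      ⟨s, hs, hi.ofReal⟩
    exact this.congr (hWae.mono fun x hx => hx.symm)
  · have e1 : ∫ x, -(iteratedDeriv 2 η x) • (hu2.toLp _ : L2R) x
        = ((-∫ x, iteratedDeriv 2 η x * u x : ℝ) : ℂ) := by
      rw [← integral_neg, ← integral_complex_ofReal]
      refine integral_congr_ae (hae.mono fun x hx => ?_)
      simp only [hx]; simp
    have e2 : ∫ x, η x • (W x • (hu2.toLp _ : L2R) x)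
        = ((-∫ x, η x * (q x * u x) : ℝ) : ℂ) := by
      rw [← integral_neg, ← integral_complex_ofReal]
      refine integral_congr_ae (hWae.mono fun x hx => ?_)
      simp only [hx]; simp
    have e3 : ∫ x, η x • ((((-(k ^ 2) : ℝ) : ℂ) • hu2.toLp _ : L2R) : ℝ → ℂ) x
        = ((-∫ x, η x * (k ^ 2 * u x) : ℝ) : ℂ) := by
      rw [← integral_neg, ← integral_complex_ofReal]
      refine integral_congr_ae ?_
      filter_upwards [hae, Lp.coeFn_smul ((-(k ^ 2) : ℝ) : ℂ) (hu2.toLp _)] with x h1 h2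
      rw [h2, Pi.smul_apply, h1]; simp
    have i1 : Integrable (fun x => η x * (k ^ 2 * u x)) :=
      (continuous_const.mul huc).locallyIntegrable.integrable_smul_left_of_hasCompactSupport
        hη.continuous hc
    have i2 : Integrable (fun x => η x * (q x * u x)) :=
      hqu.integrable_smul_left_of_hasCompactSupport hη.continuous hc
    rw [e1, e2, e3, integral_iteratedDeriv_two_mul hf hu hu' hη hc]
    simp only [mul_sub]
    rw [integral_sub i1 i2]
    push_cast; ring

end

theorem mainTheorem7 (V : ℝ → ℝ)
    (hV_int : Integrable V (volume : Measure ℝ))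
    (hV_ne : ¬ V =ᵐ[(volume : Measure ℝ)] 0)
    (hV_nonpos : ∀ᵐ x ∂(volume : Measure ℝ), V x ≤ 0)
    (hV_moment : Integrable (fun x => (1 + x ^ 2) * |V x|) (volume : Measure ℝ))
    (lam : ℝ) (hlam : 0 < lam) :
    ∃ E₀ : ℝ, E₀ < 0 ∧
      IsEigenvalue (schrodingerOp (fun x => lam * V x)) E₀ ∧
      IsGLB (energyValues (schrodingerOp (fun x => lam * V x))) E₀ := by
  set W : ℝ → ℝ := fun x => lam * V x with hW
  have hWi : Integrable W := hV_int.const_mul lam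
  -- A measurable nonnegative version of `-λV`, so that it can serve as the density of `μ`.
  set q : ℝ → ℝ≥0 := fun x => (-(hWi.1.mk W x)).toNNReal with hqdef
  have hqm : Measurable q := (hWi.1.measurable_mk.neg).real_toNNReal
  have hqW : ∀ᵐ x, (q x : ℝ) = -W x := by
    filter_upwards [hWi.1.ae_eq_mk, hV_nonpos] with x h1 h2
    rw [hqdef]
    simp only
    rw [← h1, Real.coe_toNNReal _ (by simp only [hW]; nlinarith)]
  have hWq : ∀ᵐ x, W x = -(q x : ℝ) := hqW.mono fun x hx => by rw [hx, neg_neg]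
  have hqi : Integrable fun x => (q x : ℝ) := hWi.neg.congr (hqW.mono fun x hx => hx.symm)
  have hq0 : ¬ ∀ᵐ x, q x = 0 := fun h => hV_ne (by
    filter_upwards [h, hWq] with x h1 h2
    rw [h1, NNReal.coe_zero, neg_zero] at h2
    exact (mul_eq_zero.1 h2).resolve_left hlam.ne')
  obtain ⟨k, u, u', hk, hu, hu', hpos, huk, hu2⟩ := exists_positive_eigenfunction hqm hqi hq0
  have hu2c : MemLp (fun x => (u x : ℂ)) 2 volume := hu2.ofReal
  have hS := isSchrodingerImage_of_solution hqi.locallyIntegrable hWq hu hu' hu2c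
  set ψ : L2R := hu2c.toLp _ with hψ
  have hψ0 : ψ ≠ 0 := fun h => by
    rw [Lp.eq_zero_iff_ae_eq_zero] at h
    obtain ⟨x, h1, h2⟩ := (h.and hu2c.coeFn_toLp).exists
    rw [← hψ, h1] at h2
    exact (hpos x).ne' (by simpa using h2.symm)
  have hmem := (mem_graph_schrodingerOp_iff W _ _).2 hS
  obtain ⟨y, hy1, hy2⟩ := LinearPMap.mem_graph_iff _ |>.1 hmem
  simp only at hy1 hy2
  have hTy : schrodingerOp W y = ((-(k ^ 2) : ℝ) : ℂ) • (y : L2R) := by rw [hy2, hy1]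
  have hy0 : (y : L2R) ≠ 0 := hy1 ▸ hψ0
  -- The energy `-k²` is attained at the normalized eigenvector, so any lower bound `c` of the
  -- energies is at most `-k²`.
  refine ⟨-(k ^ 2), by nlinarith, ⟨y, fun h => hy0 (by rw [h]; rfl), hTy⟩, ?_, fun c hc => hc ?_⟩
  · rintro e ⟨φ, hφ1, rfl⟩
    have hφ := (mem_graph_schrodingerOp_iff W _ _).1 (LinearPMap.mem_graph _ φ)
    have := neg_sq_norm_le_inner hqi.locallyIntegrable hWq hu hu' hpos huk hφ
    rwa [hφ1, one_pow, mul_one] at this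
  · have hn : ‖(y : L2R)‖ ≠ 0 := norm_ne_zero_iff.2 hy0
    set c : ℂ := ((‖(y : L2R)‖⁻¹ : ℝ) : ℂ)
    have hn1 : ‖((c • y : (schrodingerOp W).domain) : L2R)‖ = 1 := by
      rw [Submodule.coe_smul, norm_smul, Complex.norm_real, Real.norm_of_nonneg (by positivity),
        inv_mul_cancel₀ hn]
    refine ⟨c • y, hn1, ?_⟩
    have : schrodingerOp W (c • y)
        = ((-(k ^ 2) : ℝ) : ℂ) • ((c • y : (schrodingerOp W).domain) : L2R) := by
      rw [LinearPMap.map_smul, hTy, Submodule.coe_smul, smul_comm]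
    rw [this, inner_smul_right, inner_self_eq_norm_sq_to_K, hn1]
    simp [sq]
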